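/- **Setting.** Let $\Lambda\subseteq\mathbb R^m$ be closed and convex, $\Phi:\mathbb R^d\times\Lambda\to\mathbb R^d$, $E:\mathbb R^d\times\Lambda\to\mathbb R$. Write $\|\cdot\|$ for the Euclidean norm of vectors and the spectral norm of matrices, $\partial_i,\nabla_i$ for partial Jacobians and gradients, and $\mathbb V[X]=\mathbb E\|X-\mathbb E X\|^2$ for square-integrable $X$. Consider $\min_{\lambda\in\Lambda} f(\lambda):=E(w(\lambda),\lambda)$, where $w(\lambda)=\Phi(w(\lambda),\lambda)$. Let $\zeta,\xi$ be random variables with values in measurable spaces $Z,\Xi$, and let $\hat\Phi(w,\lambda,\zeta)$, $\hat E(w,\lambda,\xi)$ be stochastic oracles. All Lipschitz and variance constants below are nonnegative. *Assumption 1.* $\Phi,E$ are differentiable in an open set containing $\mathbb R^d\times\Lambda$. There is $q<1$ such that for every $\lambda\in\Lambda$: $\|\partial_1\Phi(w,\lambda)\|\le q$ for all $w$; $\partial_1\Phi(\cdot,\lambda),\partial_2\Phi(\cdot,\lambda),\nabla_1E(\cdot,\lambda),\nabla_2E(\cdot,\lambda),E(\cdot,\lambda)$ are Lipschitz on $\mathbb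 R^d$ with constants $\nu_1,\nu_2,\mu_1,\mu_2,L_E$. *Assumption 2.* For every $w$, $\nabla_1E(w,\cdot),\nabla_2E(w,\cdot),\partial_1\Phi(w,\cdot),\partial_2\Phi(w,\cdot)$ are Lipschitz on $\Lambda$ with constants $\bar\mu_1,\bar\mu_2,\bar\nu_1,\bar\nu_2$; and $\|\partial_2\Phi(w(\lambda),\lambda)\|\le L_\Phi$, $\|w(\lambda)\|\le B$ for all $\lambda\in\Lambda$. *Assumption 3.* $\hat\Phi,\hat E$ are measurable and, for each value of the random argument, differentiable in $(w,\lambda)$ in an open set containing $\mathbb R^d\times\Lambda$. For all $w\in\mathbb R^d$, $\lambda\in\Lambda$: $\hat E$ is integrable; $\hat\Phi,\partial_i\hat\Phi,\nabla_i\hat E$ are square integrable; the expectations of $\hat\Phi,\hat E,\partial_i\hat\Phi,\nabla_i\hat E$ are $\Phi,E,\partial_i\Phi,\nabla_iE$; and $\mathbb V[\hat\Phi(w,\lambda,\zeta)]\le\sigma_1+\sigma_2\|\Phi(w,\lambda)-w\|^2$, $\mathbb V[\partial_i\hat\Phi(w,\lambda,\zeta)]\le\sigma'_i$, $\mathbb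 V[\nabla_i\hat E(w,\lambda,\xi)]\le\sigma_{i,E}$ for $i=1,2$. **Algorithm SID** (inputs $t,k,J,\lambda$, stepsizes $\eta_i$). Set $w_0=0$ and $w_{i+1}=w_i+\eta_i(\hat\Phi(w_i,\lambda,\zeta_i)-w_i)$ for $i<t$. With samples $\xi_1,\dots,\xi_J$ put $\nabla_i\bar E_J=\frac1J\sum_{j}\nabla_i\hat E(w_t,\lambda,\xi_j)$. Set $v_0=0$ and $v_{i+1}=v_i+\eta_i(\partial_1\hat\Phi(w_t,\lambda,\hat\zeta_i)^\top v_i+\nabla_1\bar E_J-v_i)$ for $i<k$. With $J$ further samples $\tilde\zeta_j$ of $\zeta$, return $\hat\nabla f(\lambda)=\nabla_2\bar E_J+\big(\frac1J\sum_j\partial_2\hat\Phi(w_t,\lambda,\tilde\zeta_j)\big)^\top v_k$. One call uses $t+k+2J$ samples. **Algorithm BSGM.** From $\lambda_0\in\Lambda$ iterate $\lambda_{s+1}=P_\Lambda(\lambda_s-\alpha\hat\nabla f(\lambda_s))$, where $P_\Lambda$ is the projection onto $\Lambda$ and $\hat\nabla f(\lambda_s)$ is computed by SID with $t=t_s,k=k_s,J=J_s$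 (no warm-start). All samples, within and across iterations, are mutually independent copies of $\zeta$ or $\xi$. The number of samples used in $S$ iterations is $N_S=\sum_{s<S}(t_s+k_s+2J_s)$. **Constants.** Let $$L_{w'}=\tfrac{\bar\nu_2}{1-q}+\tfrac{L_\Phi}{(1-q)^2}\Big(\nu_2+\bar\nu_1+\tfrac{\nu_1L_\Phi}{1-q}\Big),\quad L_f=\bar\mu_2+L_EL_{w'}+\tfrac{L_\Phi}{1-q}\Big(\mu_2+\bar\mu_1+\tfrac{\mu_1L_\Phi}{1-q}\Big),$$ $$c_1=\mu_2+\tfrac{\mu_1L_\Phi+\nu_2L_E}{1-q}+\tfrac{\nu_1L_EL_\Phi}{(1-q)^2},\quad \tilde\sigma_2=\max\Big\{\tfrac{2\sigma'_1}{(1-q)^2},\sigma_2\Big\},\quad d_w=\max\Big\{\gamma B^2,\tfrac{\beta^2\sigma_1}{\beta(1-q^2)-1}\Big\},$$ $$d_v=\max\Big\{\tfrac{L_E^2+\sigma_{1,E}}{(1-q)^2}\gamma,\ \tfrac{2(L_E^2+\sigma_{1,E})\sigma'_1}{(1-q)^2}\tfrac{\beta^2}{\beta(1-q^2)-1}\Big\},\quad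 c_b=3c_1^2d_w+3L_\Phi^2d_v+3\nu_2^2d_wd_v,$$ $$c_v=\sigma_{2,E}+8\tfrac{\sigma'_2(L_E^2+\sigma_{1,E})+L_\Phi^2\sigma_{1,E}}{(1-q)^2}+\Big(3c_1^2+\tfrac{8\nu_2^2\sigma_{1,E}}{(1-q)^2}\Big)d_w+(11L_\Phi^2+8\sigma'_2)d_v+11\nu_2^2d_vd_w .$$ **Theorem.** Suppose Assumptions 1–3 hold and $f$ is bounded below on $\Lambda$. Let $\eta_j=\beta/(\gamma+j)$ with $\beta>1/(1-q^2)$ and $\gamma\ge\beta(1+\tilde\sigma_2)$, let $L_f>0$, $0<\alpha\le 1/L_f$, $c_3>0$, $\lambda_0\in\Lambda$, $\Delta_f=f(\lambda_0)-\inf_\Lambda f$. Then at every $\lambda\in\Lambda$ the function $f$ is differentiable relative to $\Lambda$ with gradient $$\nabla f(\lambda)=\nabla_2E(w(\lambda),\lambda)+\partial_2\Phi(w(\lambda),\lambda)^\top\big(I-\partial_1\Phi(w(\lambda),\lambda)^\top\big)^{-1}\nabla_1E(w(\lambda),\lambda).$$ With $G_\alpha(\lambda)=\alpha^{-1}(\lambda-P_\Lambda(\lambda-\alpha\nabla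 f(\lambda)))$, the random variables $\|G_\alpha(\lambda_s)\|^2$ below are integrable, and: (i) If BSGM is run with $t_s=k_s=J_s=\lceil c_3(s+1)\rceil$ for all $s$, then for every $S\ge1$ $$\frac1S\sum_{s=0}^{S-1}\mathbb E\|G_\alpha(\lambda_s)\|^2\le\frac1{S\alpha}\Big[8\Delta_f+\frac{10}{L_f}\frac{c_b+c_v}{c_3}(\log S+1)\Big].$$ Moreover the sample complexity is $\tilde O(\epsilon^{-2})$: there is $C$, independent of $\epsilon$, such that for every $\epsilon\in(0,1]$ there is $S_0\ge1$ with $N_{S_0}\le C\epsilon^{-2}(1+\log(1/\epsilon))^2$ such that for every $S\ge S_0$ some $s^*\le S-1$ satisfies $\mathbb E\|G_\alpha(\lambda_{s^*})\|^2\le\epsilon$. (ii) (Finite horizon.) If, for each $S\ge 1$, BSGM is run with $t_s=k_s=J_s=\lceil c_3S\rceil$ for $s=0,\dots,S-1$, then for every $S\ge1$ $$\frac1S\sum_{s=0}^{S-1}\mathbb E\|G_\alpha(\lambda_s)\|^2\le\frac1{S\alpha}\Big[8\Delta_f+\frac{10}{L_f}\frac{c_b+c_v}{c_3}\Big].$$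 Moreover the sample complexity is $O(\epsilon^{-2})$: there is $C$, independent of $\epsilon$, such that for every $\epsilon\in(0,1]$ there is $S_0\ge1$ such that the run with horizon $S_0$ uses at most $C\epsilon^{-2}$ samples, and for every $S\ge S_0$ the run with horizon $S$ has some $s^*\le S-1$ with $\mathbb E\|G_\alpha(\lambda_{s^*})\|^2\le\epsilon$. -/

import Mathlib

open MeasureTheory ProbabilityTheory
open scoped InnerProductSpace

noncomputable section

namespace Bilevel

/-- `ℝⁿ` with the Euclidean norm; linear maps between such spaces carry the spectral norm. -/
abbrev Vec (n : ℕ) := EuclideanSpace ℝ (Fin n)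

/-- Variance `𝔼 ‖X - 𝔼 X‖²` of a random element of a normed space (for Jacobians the norm is the
spectral norm). It is only used for square integrable `X`. -/
def vecVar {Z V : Type*} [MeasurableSpace Z] [NormedAddCommGroup V] [NormedSpace ℝ V]
    (μ : Measure Z) (X : Z → V) : ℝ :=
  ∫ z, ‖X z - ∫ z', X z' ∂μ‖ ^ 2 ∂μ

/-- Partial Jacobian with respect to the first variable. -/
def D1 {d m k : ℕ} (h : Vec d → Vec m → Vec k) (w : Vec d) (l : Vec m) : Vec d →L[ℝ] Vec k :=
  fderiv ℝ (fun w' => h w' l) w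

/-- Partial Jacobian with respect to the second variable. -/
def D2 {d m k : ℕ} (h : Vec d → Vec m → Vec k) (w : Vec d) (l : Vec m) : Vec m →L[ℝ] Vec k :=
  fderiv ℝ (fun l' => h w l') l

/-- Partial gradient with respect to the first variable. -/
def grad1 {d m : ℕ} (g : Vec d → Vec m → ℝ) (w : Vec d) (l : Vec m) : Vec d :=
  gradient (fun w' => g w' l) w

/-- Partial gradient with respect to the second variable. -/
def grad2 {d m : ℕ} (g : Vec d → Vec m → ℝ) (w : Vec d) (l : Vec m) : Vec m :=
  gradient (fun l' => g w l') l

/-- The data of a stochastic bilevel problem: minimise `E (w(l), l)` over `l ∈ Lam`, subject to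
`w(l) = Phi (w(l), l)`, with stochastic oracles `Phihat`, `Ehat` for `Phi`, `E`; `lawZ` and
`lawX` are the laws of the random variables `ζ` and `ξ`. -/
structure Problem (d m : ℕ) (Z Ξ : Type*) [MeasurableSpace Z] [MeasurableSpace Ξ] where
  Lam : Set (Vec m)
  Phi : Vec d → Vec m → Vec d
  E : Vec d → Vec m → ℝ
  Phihat : Vec d → Vec m → Z → Vec d
  Ehat : Vec d → Vec m → Ξ → ℝ
  lawZ : Measure Z
  lawX : Measure Ξ

/-- The constants that quantify the regularity of the problem. -/
structure Constants where
  /-- contraction constant of `Phi (·, l)` -/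
  q : ℝ
  /-- Lipschitz constants of `∂₁Phi (·, l)`, `∂₂Phi (·, l)` -/
  nu1 : ℝ
  nu2 : ℝ
  /-- Lipschitz constants of `∇₁E (·, l)`, `∇₂E (·, l)` -/
  mu1 : ℝ
  mu2 : ℝ
  /-- Lipschitz constant of `E (·, l)` -/
  LE : ℝ
  /-- Lipschitz constants of `∇₁E (w, ·)`, `∇₂E (w, ·)` -/
  mubar1 : ℝ
  mubar2 : ℝ
  /-- Lipschitz constants of `∂₁Phi (w, ·)`, `∂₂Phi (w, ·)` -/
  nubar1 : ℝ
  nubar2 : ℝ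
  /-- bound on `∂₂Phi (w(l), l)` -/
  LPhi : ℝ
  /-- bound on `w(l)` -/
  B : ℝ
  /-- variance constants `σ₁, σ₂` of `Phihat` -/
  sig1 : ℝ
  sig2 : ℝ
  /-- variance constants `σ'₁, σ'₂` of `∂₁Phihat`, `∂₂Phihat` -/
  sig1' : ℝ
  sig2' : ℝ
  /-- variance constants `σ₁,E`, `σ₂,E` of `∇₁Ehat`, `∇₂Ehat` -/
  sigE1 : ℝ
  sigE2 : ℝ

namespace Constants

variable (c : Constants)

/-- All Lipschitz and variance constants are nonnegative (`q`, `LPhi` and `B` are bounds on norms,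
so their nonnegativity is automatic). -/
structure Nonneg : Prop where
  nu1 : 0 ≤ c.nu1
  nu2 : 0 ≤ c.nu2
  mu1 : 0 ≤ c.mu1
  mu2 : 0 ≤ c.mu2
  LE : 0 ≤ c.LE
  mubar1 : 0 ≤ c.mubar1
  mubar2 : 0 ≤ c.mubar2
  nubar1 : 0 ≤ c.nubar1
  nubar2 : 0 ≤ c.nubar2
  sig1 : 0 ≤ c.sig1
  sig2 : 0 ≤ c.sig2
  sig1' : 0 ≤ c.sig1'
  sig2' : 0 ≤ c.sig2'
  sigE1 : 0 ≤ c.sigE1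
  sigE2 : 0 ≤ c.sigE2

/-- Lipschitz constant of the derivative of `w(·)`. -/
def Lw' : ℝ :=
  c.nubar2 / (1 - c.q)
    + c.LPhi / (1 - c.q) ^ 2 * (c.nu2 + c.nubar1 + c.nu1 * c.LPhi / (1 - c.q))

/-- Lipschitz constant of the hypergradient. -/
def Lf : ℝ :=
  c.mubar2 + c.LE * c.Lw'
    + c.LPhi / (1 - c.q) * (c.mu2 + c.mubar1 + c.mu1 * c.LPhi / (1 - c.q))

def c1 : ℝ :=
  c.mu2 + (c.mu1 * c.LPhi + c.nu2 * c.LE) / (1 - c.q) + c.nu1 * c.LE * c.LPhi / (1 - c.q) ^ 2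

def sigTilde2 : ℝ := max (2 * c.sig1' / (1 - c.q) ^ 2) c.sig2

def dw (β γ : ℝ) : ℝ :=
  max (γ * c.B ^ 2) (β ^ 2 * c.sig1 / (β * (1 - c.q ^ 2) - 1))

def dv (β γ : ℝ) : ℝ :=
  max ((c.LE ^ 2 + c.sigE1) / (1 - c.q) ^ 2 * γ)
    (2 * (c.LE ^ 2 + c.sigE1) * c.sig1' / (1 - c.q) ^ 2
      * (β ^ 2 / (β * (1 - c.q ^ 2) - 1)))

def cb (β γ : ℝ) : ℝ :=
  3 * c.c1 ^ 2 * c.dw β γ + 3 * c.LPhi ^ 2 * c.dv β γ + 3 * c.nu2 ^ 2 * c.dw β γ * c.dv β γ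

def cv (β γ : ℝ) : ℝ :=
  c.sigE2 + 8 * ((c.sig2' * (c.LE ^ 2 + c.sigE1) + c.LPhi ^ 2 * c.sigE1) / (1 - c.q) ^ 2)
    + (3 * c.c1 ^ 2 + 8 * c.nu2 ^ 2 * c.sigE1 / (1 - c.q) ^ 2) * c.dw β γ
    + (11 * c.LPhi ^ 2 + 8 * c.sig2') * c.dv β γ
    + 11 * c.nu2 ^ 2 * c.dv β γ * c.dw β γ

end Constants

/-- Metric projection onto `s`: a point of `s` nearest to `x` (it exists and is unique when `s` is
nonempty, closed and convex). -/
def proj {m : ℕ} (s : Set (Vec m)) (x : Vec m) : Vec m :=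
  Classical.epsilon fun p => p ∈ s ∧ ∀ y ∈ s, ‖x - p‖ ≤ ‖x - y‖

theorem proj_spec {m : ℕ} {s : Set (Vec m)} (hne : s.Nonempty) (hcl : IsClosed s) (x : Vec m) :
    proj s x ∈ s ∧ ∀ y ∈ s, ‖x - proj s x‖ ≤ ‖x - y‖ := by
  have h : ∃ p, p ∈ s ∧ ∀ y ∈ s, ‖x - p‖ ≤ ‖x - y‖ := by
    obtain ⟨p, hp, hd⟩ := hcl.exists_infDist_eq_dist hne x
    refine ⟨p, hp, fun y hy => ?_⟩
    rw [← dist_eq_norm, ← dist_eq_norm, ← hd]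
    exact Metric.infDist_le_dist_of_mem hy
  exact Classical.epsilon_spec h

section ProblemDefs

variable {d m : ℕ} {Z Ξ : Type*} [MeasurableSpace Z] [MeasurableSpace Ξ] (P : Problem d m Z Ξ)

namespace Problem

/-- Lower-level solution `w(l)`: the fixed point of `Phi (·, l)`. -/
def lower (l : Vec m) : Vec d :=
  Classical.epsilon fun w => P.Phi w l = w

/-- Upper-level objective `f(l) = E (w(l), l)`. -/
def f (l : Vec m) : ℝ := P.E (P.lower l) l

/-- Solution `v(w, l)` of the linear system `(I - ∂₁Phi(w,l)ᵀ) v = ∇₁E(w,l)`. -/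
def linSol (w : Vec d) (l : Vec m) : Vec d :=
  Ring.inverse (1 - ContinuousLinearMap.adjoint (D1 P.Phi w l)) (grad1 P.E w l)

/-- Hypergradient `∇f(l) = ∇₂E(w(l),l) + ∂₂Phi(w(l),l)ᵀ v(w(l),l)`. -/
def hypergrad (l : Vec m) : Vec m :=
  grad2 P.E (P.lower l) l
    + ContinuousLinearMap.adjoint (D2 P.Phi (P.lower l) l) (P.linSol (P.lower l) l)

/-- Proximal gradient mapping `G_α(l) = α⁻¹ (l - P_Lam (l - α ∇f(l)))`. -/
def proxGrad (α : ℝ) (l : Vec m) : Vec m :=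
  α⁻¹ • (l - proj P.Lam (l - α • P.hypergrad l))

/-- `Δ_f = f(l₀) - inf_Lam f`. -/
def gap (l₀ : Vec m) : ℝ := P.f l₀ - sInf (P.f '' P.Lam)

/-- Basic assumption: feasible set, differentiability, contraction, and Lipschitz continuity in
the lower-level variable. -/
structure Regular (c : Constants) : Prop where
  closed : IsClosed P.Lam
  convex : Convex ℝ P.Lam
  diff : ∃ U : Set (Vec d × Vec m), IsOpen U ∧ Set.univ ×ˢ P.Lam ⊆ U ∧
    DifferentiableOn ℝ (fun p : Vec d × Vec m => P.Phi p.1 p.2) U ∧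
    DifferentiableOn ℝ (fun p : Vec d × Vec m => P.E p.1 p.2) U
  q_lt_one : c.q < 1
  contraction : ∀ l ∈ P.Lam, ∀ w, ‖D1 P.Phi w l‖ ≤ c.q
  lip_D1 : ∀ l ∈ P.Lam, ∀ w w', ‖D1 P.Phi w l - D1 P.Phi w' l‖ ≤ c.nu1 * ‖w - w'‖
  lip_D2 : ∀ l ∈ P.Lam, ∀ w w', ‖D2 P.Phi w l - D2 P.Phi w' l‖ ≤ c.nu2 * ‖w - w'‖
  lip_grad1 : ∀ l ∈ P.Lam, ∀ w w', ‖grad1 P.E w l - grad1 P.E w' l‖ ≤ c.mu1 * ‖w - w'‖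
  lip_grad2 : ∀ l ∈ P.Lam, ∀ w w', ‖grad2 P.E w l - grad2 P.E w' l‖ ≤ c.mu2 * ‖w - w'‖
  lip_E : ∀ l ∈ P.Lam, ∀ w w', |P.E w l - P.E w' l| ≤ c.LE * ‖w - w'‖

/-- Additional assumption: Lipschitz continuity in the upper-level variable, and bounds along the
solution path. -/
structure UpperRegular (c : Constants) : Prop where
  lip_grad1 : ∀ w, ∀ l ∈ P.Lam, ∀ l' ∈ P.Lam,
    ‖grad1 P.E w l - grad1 P.E w l'‖ ≤ c.mubar1 * ‖l - l'‖
  lip_grad2 : ∀ w, ∀ l ∈ P.Lam, ∀ l' ∈ P.Lam,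
    ‖grad2 P.E w l - grad2 P.E w l'‖ ≤ c.mubar2 * ‖l - l'‖
  lip_D1 : ∀ w, ∀ l ∈ P.Lam, ∀ l' ∈ P.Lam,
    ‖D1 P.Phi w l - D1 P.Phi w l'‖ ≤ c.nubar1 * ‖l - l'‖
  lip_D2 : ∀ w, ∀ l ∈ P.Lam, ∀ l' ∈ P.Lam,
    ‖D2 P.Phi w l - D2 P.Phi w l'‖ ≤ c.nubar2 * ‖l - l'‖
  bound_D2 : ∀ l ∈ P.Lam, ‖D2 P.Phi (P.lower l) l‖ ≤ c.LPhi
  bound_lower : ∀ l ∈ P.Lam, ‖P.lower l‖ ≤ c.B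

/-- Assumption on the stochastic oracles: measurability, differentiability, unbiasedness
(also of the derivatives), finite second moments and variance bounds. -/
structure Oracle (c : Constants) : Prop where
  probZ : IsProbabilityMeasure P.lawZ
  probX : IsProbabilityMeasure P.lawX
  meas_Phihat : Measurable fun p : (Vec d × Vec m) × Z => P.Phihat p.1.1 p.1.2 p.2
  meas_Ehat : Measurable fun p : (Vec d × Vec m) × Ξ => P.Ehat p.1.1 p.1.2 p.2
  diff_Phihat : ∀ z, ∃ U : Set (Vec d × Vec m), IsOpen U ∧ Set.univ ×ˢ P.Lam ⊆ U ∧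
    DifferentiableOn ℝ (fun p : Vec d × Vec m => P.Phihat p.1 p.2 z) U
  diff_Ehat : ∀ x, ∃ U : Set (Vec d × Vec m), IsOpen U ∧ Set.univ ×ˢ P.Lam ⊆ U ∧
    DifferentiableOn ℝ (fun p : Vec d × Vec m => P.Ehat p.1 p.2 x) U
  memLp_Phihat : ∀ w, ∀ l ∈ P.Lam, MemLp (fun z => P.Phihat w l z) 2 P.lawZ
  memLp_D1 : ∀ w, ∀ l ∈ P.Lam, MemLp (fun z => D1 (fun w l => P.Phihat w l z) w l) 2 P.lawZ
  memLp_D2 : ∀ w, ∀ l ∈ P.Lam, MemLp (fun z => D2 (fun w l => P.Phihat w l z) w l) 2 P.lawZ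
  int_Ehat : ∀ w, ∀ l ∈ P.Lam, Integrable (fun x => P.Ehat w l x) P.lawX
  memLp_grad1 : ∀ w, ∀ l ∈ P.Lam,
    MemLp (fun x => grad1 (fun w l => P.Ehat w l x) w l) 2 P.lawX
  memLp_grad2 : ∀ w, ∀ l ∈ P.Lam,
    MemLp (fun x => grad2 (fun w l => P.Ehat w l x) w l) 2 P.lawX
  mean_Phihat : ∀ w, ∀ l ∈ P.Lam, ∫ z, P.Phihat w l z ∂P.lawZ = P.Phi w l
  mean_D1 : ∀ w, ∀ l ∈ P.Lam, ∫ z, D1 (fun w l => P.Phihat w l z) w l ∂P.lawZ = D1 P.Phi w l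
  mean_D2 : ∀ w, ∀ l ∈ P.Lam, ∫ z, D2 (fun w l => P.Phihat w l z) w l ∂P.lawZ = D2 P.Phi w l
  mean_Ehat : ∀ w, ∀ l ∈ P.Lam, ∫ x, P.Ehat w l x ∂P.lawX = P.E w l
  mean_grad1 : ∀ w, ∀ l ∈ P.Lam,
    ∫ x, grad1 (fun w l => P.Ehat w l x) w l ∂P.lawX = grad1 P.E w l
  mean_grad2 : ∀ w, ∀ l ∈ P.Lam,
    ∫ x, grad2 (fun w l => P.Ehat w l x) w l ∂P.lawX = grad2 P.E w l
  var_Phihat : ∀ w, ∀ l ∈ P.Lam,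
    vecVar P.lawZ (fun z => P.Phihat w l z) ≤ c.sig1 + c.sig2 * ‖P.Phi w l - w‖ ^ 2
  var_D1 : ∀ w, ∀ l ∈ P.Lam,
    vecVar P.lawZ (fun z => D1 (fun w l => P.Phihat w l z) w l) ≤ c.sig1'
  var_D2 : ∀ w, ∀ l ∈ P.Lam,
    vecVar P.lawZ (fun z => D2 (fun w l => P.Phihat w l z) w l) ≤ c.sig2'
  var_grad1 : ∀ w, ∀ l ∈ P.Lam,
    vecVar P.lawX (fun x => grad1 (fun w l => P.Ehat w l x) w l) ≤ c.sigE1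
  var_grad2 : ∀ w, ∀ l ∈ P.Lam,
    vecVar P.lawX (fun x => grad2 (fun w l => P.Ehat w l x) w l) ≤ c.sigE2

variable {P} in
/-- Under the basic assumption the lower-level problem has exactly one solution, `P.lower l`. -/
theorem Regular.fixed_iff {c : Constants} (h : P.Regular c) {l : Vec m} (hl : l ∈ P.Lam)
    (w : Vec d) : P.Phi w l = w ↔ w = P.lower l := by
  obtain ⟨U, hU, hsub, hPhi, -⟩ := h.diff
  have hd : Differentiable ℝ (fun w => P.Phi w l) := fun w => by
    have h1 := hPhi.differentiableAt (hU.mem_nhds (hsub (Set.mk_mem_prod (Set.mem_univ w) hl)))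
    have h2 : DifferentiableAt ℝ (fun w : Vec d => (w, l)) w :=
      differentiableAt_id.prodMk (differentiableAt_const l)
    exact DifferentiableAt.comp (g := fun p : Vec d × Vec m => P.Phi p.1 p.2) w h1 h2
  have hlip : ∀ x y, ‖P.Phi x l - P.Phi y l‖ ≤ c.q * ‖x - y‖ := fun x y =>
    Convex.norm_image_sub_le_of_norm_fderiv_le (𝕜 := ℝ) (s := Set.univ)
      (fun z _ => hd z) (fun z _ => h.contraction l hl z) convex_univ (Set.mem_univ y)
      (Set.mem_univ x)
  have hq : 0 ≤ c.q := (norm_nonneg _).trans (h.contraction l hl 0)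
  have hcw : ContractingWith ⟨c.q, hq⟩ (fun w => P.Phi w l) :=
    ⟨h.q_lt_one, LipschitzWith.of_dist_le_mul fun x y => by
      rw [dist_eq_norm, dist_eq_norm]; exact hlip x y⟩
  have hex : ∃ w, P.Phi w l = w := ⟨_, hcw.fixedPoint_isFixedPt⟩
  have hs : P.Phi (P.lower l) l = P.lower l := Classical.epsilon_spec hex
  refine ⟨fun hw => ?_, fun hw => hw ▸ hs⟩
  exact hcw.fixedPoint_unique' hw hs

end Problem

/-! ### The algorithms -/

/-- Lower-level solver on the samples `z`, from `w₀ = 0`: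
`w_{i+1} = w_i + η_i (Phihat(w_i, l, z_i) - w_i)`. -/
def llSolver (η : ℕ → ℝ) (l : Vec m) (z : ℕ → Z) : ℕ → Vec d
  | 0 => 0
  | i + 1 => llSolver η l z i + η i • (P.Phihat (llSolver η l z i) l (z i) - llSolver η l z i)

/-- Mini-batch estimators of `∇₁E`, `∇₂E` (samples of `ξ`) and `∂₂Phi` (samples of `ζ`). -/
def batchGrad1 (J : ℕ) (x : ℕ → Ξ) (w : Vec d) (l : Vec m) : Vec d :=
  (J : ℝ)⁻¹ • ∑ j ∈ Finset.range J, grad1 (fun w l => P.Ehat w l (x j)) w l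

def batchGrad2 (J : ℕ) (x : ℕ → Ξ) (w : Vec d) (l : Vec m) : Vec m :=
  (J : ℝ)⁻¹ • ∑ j ∈ Finset.range J, grad2 (fun w l => P.Ehat w l (x j)) w l

def batchD2 (J : ℕ) (z : ℕ → Z) (w : Vec d) (l : Vec m) : Vec m →L[ℝ] Vec d :=
  (J : ℝ)⁻¹ • ∑ j ∈ Finset.range J, D2 (fun w l => P.Phihat w l (z j)) w l

/-- Linear-system solver on the samples `z`, from `v₀ = 0`:
`v_{i+1} = v_i + η_i (∂₁Phihat(w, l, z_i)ᵀ v_i + g - v_i)`, where `g` is the mini-batch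
estimator of `∇₁E(w, l)`. -/
def lsSolver (η : ℕ → ℝ) (w : Vec d) (l : Vec m) (g : Vec d) (z : ℕ → Z) : ℕ → Vec d
  | 0 => 0
  | i + 1 => lsSolver η w l g z i
      + η i • (ContinuousLinearMap.adjoint (D1 (fun w l => P.Phihat w l (z i)) w l)
          (lsSolver η w l g z i) + g - lsSolver η w l g z i)

/-- Stochastic implicit differentiation (without warm-start). It draws the samples `zLL i`
(`i < t`), `x j` (`j < J`), `zLS i` (`i < k`) and `zJac j` (`j < J`). -/
def sid (η : ℕ → ℝ) (t k J : ℕ) (l : Vec m) (zLL : ℕ → Z) (x : ℕ → Ξ) (zLS zJac : ℕ → Z) :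
    Vec m :=
  let w := llSolver P η l zLL t
  let v := lsSolver P η w l (batchGrad1 P J x w l) zLS k
  batchGrad2 P J x w l + ContinuousLinearMap.adjoint (batchD2 P J zJac w l) v

/-- Number of samples of `ζ` and `ξ` drawn by one call of `sid`. -/
def sidSamples (t k J : ℕ) : ℕ := t + J + k + J

/-- The three steps of `sid` that sample `ζ`. -/
inductive Step
  | lowerLevel
  | linearSystem
  | jacobian

/-- The samples of a run: `zeta (p, s, i)` is the `i`-th sample of `ζ` in step `p` of upper-level
iteration `s`, and `xi (s, j)` is the `j`-th sample of `ξ` in upper-level iteration `s`. -/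
structure Samples (Ω Z Ξ : Type*) where
  zeta : Step × ℕ × ℕ → Ω → Z
  xi : ℕ × ℕ → Ω → Ξ

/-- All samples are mutually independent, the `zeta`s with the law of `ζ` and the `xi`s with the
law of `ξ`. -/
structure Samples.IsIID {Ω : Type*} [MeasurableSpace Ω] (Pr : Measure Ω) (X : Samples Ω Z Ξ) :
    Prop where
  meas_zeta : ∀ a, Measurable (X.zeta a)
  meas_xi : ∀ a, Measurable (X.xi a)
  law_zeta : ∀ a, Pr.map (X.zeta a) = P.lawZ
  law_xi : ∀ a, Pr.map (X.xi a) = P.lawX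
  indep : iIndep
    (Sum.elim (fun a => MeasurableSpace.comap (X.zeta a) inferInstance)
      (fun a => MeasurableSpace.comap (X.xi a) inferInstance)) Pr

/-- Bilevel stochastic gradient method with upper-level stepsize `α`, solver stepsizes `η`, and
`t s`, `k s`, `J s` solver iterations and mini-batch size at iteration `s`:
`l_{s+1} = P_Lam (l_s - α · sid(l_s))`. -/
def bsgm {Ω : Type*} (α : ℝ) (η : ℕ → ℝ) (t k J : ℕ → ℕ) (X : Samples Ω Z Ξ) (l₀ : Vec m) :
    ℕ → Ω → Vec m
  | 0, _ => l₀
  | s + 1, ω =>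
      let l := bsgm α η t k J X l₀ s ω
      proj P.Lam (l - α • sid P η (t s) (k s) (J s) l
        (fun i => X.zeta (Step.lowerLevel, s, i) ω) (fun j => X.xi (s, j) ω)
        (fun i => X.zeta (Step.linearSystem, s, i) ω)
        (fun j => X.zeta (Step.jacobian, s, j) ω))

/-- Total number of samples of `ζ` and `ξ` drawn in `S` iterations of `bsgm`. -/
def bsgmSamples (t k J : ℕ → ℕ) (S : ℕ) : ℕ :=
  ∑ s ∈ Finset.range S, sidSamples (t s) (k s) (J s)

end ProblemDefs

end Bilevel

end

open Bilevel

/-!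
Why the theorem holds. Differentiating the fixed-point equation `w(l) = Phi(w(l), l)` relative to
`Lam` (`Problem.Regular.hasFDerivWithinAt_lower`) identifies the hypergradient as the gradient of
`f` relative to `Lam`, and the regularity assumptions make it `Lf`-Lipschitz there
(`Problem.Regular.lipschitz_hypergrad`), so `f` satisfies the descent inequality on `Lam`.

Let `e` be the error of the stochastic hypergradient at `l`. Since the proximal model of `f` at
`l` is `1/α`-strongly convex, one projected step to `l⁺` satisfies, along every sample path,
`α ‖G_α(l)‖² ≤ 2 (f(l) - f(l⁺)) + α ‖e‖²` (`norm_sq_proxGrad_le`). Summation telescopes the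
objective. Neither unbiasedness of the stochastic hypergradient nor a split into bias and variance
is needed, only a bound on its mean square error. The claimed estimates leave room for a factor `10`
in front of `‖e‖²`, and here it is `1`; so the mean square error may be as large as
`10 (c_b + c_v) / J`, which a crude splitting into five terms achieves even though the mini-batch
estimators of `∇₁E` and `∇₂E` share their samples and are correlated.

The mean square error (`lintegral_sid_sub_hypergrad_sq_le`) rests on two facts about samples
independent of the past. Centred mini-batch sums have second moments that add up
(`IsFreshStream.lintegral_norm_sum_sq_le`), and averaged stochastic iterations of a contraction
converge at rate `1 / (γ + i)` (`IsFreshStream.lintegral_norm_iterate_sub_sq_le`). The latter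
covers both the lower-level solver and the linear-system solver. Both facts carry a weight that
depends on the past, because the error of the linear-system solver is multiplied by
`‖∂₂Phi(w,l)‖²`, which is random and controlled only through `‖w - w(l)‖²`. Second moments are
Lebesgue integrals in `[0, ∞]`, so that integrability is a conclusion and never a side condition.

Joint measurability of the derivatives of the oracles in the point and the sample is not assumed.
It follows on `Lam` by writing directional derivatives as limits of difference quotients
(`measurable_fderiv_prod`), which is why
random feasible points are treated as random elements of the subtype `P.Lam`.
-/

namespace Bilevel

open scoped ENNReal

/-! ### Projections and the projected gradient step -/

theorem inner_sub_proj_nonpos {m : ℕ} {s : Set (Vec m)} (hcl : IsClosed s)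
    (hconv : Convex ℝ s) (x : Vec m) {y : Vec m} (hy : y ∈ s) :
    ⟪x - proj s x, y - proj s x⟫_ℝ ≤ 0 := by
  obtain ⟨hmem, hmin⟩ := proj_spec ⟨y, hy⟩ hcl x
  refine (norm_eq_iInf_iff_real_inner_le_zero hconv hmem).1 ?_ y hy
  have : Nonempty s := ⟨⟨y, hy⟩⟩
  refine le_antisymm (le_ciInf fun w => hmin w w.2) ?_
  exact ciInf_le ⟨0, by rintro _ ⟨w, rfl⟩; exact norm_nonneg _⟩ (⟨_, hmem⟩ : s)

theorem lipschitzWith_proj {m : ℕ} {s : Set (Vec m)} (hne : s.Nonempty) (hcl : IsClosed s)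
    (hconv : Convex ℝ s) : LipschitzWith 1 (proj s) := by
  refine LipschitzWith.of_dist_le_mul fun x y => ?_
  rw [dist_eq_norm, dist_eq_norm, NNReal.coe_one, one_mul]
  have hx := inner_sub_proj_nonpos hcl hconv x (proj_spec hne hcl y).1
  have hy := inner_sub_proj_nonpos hcl hconv y (proj_spec hne hcl x).1
  set p := proj s x
  set r := proj s y
  have h1 : ‖p - r‖ ^ 2 ≤ ⟪x - y, p - r⟫_ℝ := by
    rw [← real_inner_self_eq_norm_sq]
    simp only [inner_sub_left, inner_sub_right] at hx hy ⊢
    linarith [real_inner_comm p r, real_inner_comm x p, real_inner_comm x r]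
  have h2 := real_inner_le_norm (x - y) (p - r)
  by_contra! h
  have h3 : 0 < ‖p - r‖ := (norm_nonneg _).trans_lt h
  nlinarith

/-- Progress of one projected step along the inexact gradient `g + e`, in terms of the proximal
gradient mapping of the exact gradient `g`. The quadratic model `⟪g, y - l⟫ + ‖y - l‖² / (2 α)` is
`1/α`-strongly convex, so perturbing its linear part by `e` costs at most `α ‖e‖² / 2`. -/
theorem norm_sq_proxGrad_le {m : ℕ} {s : Set (Vec m)} (hcl : IsClosed s)
    (hconv : Convex ℝ s) {φ : Vec m → ℝ} {g e l : Vec m} {α L : ℝ} (hl : l ∈ s) (hα : 0 < α)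
    (hαL : L * α ≤ 1)
    (hdesc : ∀ y ∈ s, φ y ≤ φ l + ⟪g, y - l⟫_ℝ + L / 2 * ‖y - l‖ ^ 2) :
    α * ‖α⁻¹ • (l - proj s (l - α • g))‖ ^ 2
      ≤ 2 * (φ l - φ (proj s (l - α • (g + e)))) + α * ‖e‖ ^ 2 := by
  have hp := (proj_spec ⟨l, hl⟩ hcl (l - α • g)).1
  have hp' := (proj_spec ⟨l, hl⟩ hcl (l - α • (g + e))).1
  have h1 := inner_sub_proj_nonpos hcl hconv (l - α • g) hl
  have h2 := inner_sub_proj_nonpos hcl hconv (l - α • (g + e)) hp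
  have h3 := hdesc _ hp'
  set p := proj s (l - α • g)
  set p' := proj s (l - α • (g + e))
  obtain ⟨u, hu⟩ : ∃ u, u = l - p := ⟨_, rfl⟩
  obtain ⟨x, hx⟩ : ∃ x, x = p - p' := ⟨_, rfl⟩
  have e1 : l - α • g - p = u - α • g := by rw [hu]; abel
  have e2 : l - α • (g + e) - p' = u + x - α • g - α • e := by
    rw [hu, hx, smul_add]; abel
  have e3 : p' - l = -(u + x) := by rw [hu, hx]; abel
  rw [e1, ← hu] at h1
  rw [e2, ← hx] at h2
  rw [e3, norm_neg] at h3
  have h4 : 0 ≤ ‖x - α • e‖ ^ 2 := sq_nonneg _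
  rw [← hu, norm_smul, Real.norm_of_nonneg (inv_nonneg.2 hα.le), mul_pow]
  have h5 : L * α * ‖u + x‖ ^ 2 ≤ 1 * ‖u + x‖ ^ 2 := by gcongr
  have h3' := mul_le_mul_of_nonneg_left h3 hα.le
  have h6 : α * (α * ((α⁻¹) ^ 2 * ‖u‖ ^ 2)) = ‖u‖ ^ 2 := by field_simp
  refine le_of_mul_le_mul_left ?_ hα
  rw [h6]
  simp only [← real_inner_self_eq_norm_sq, inner_sub_left, inner_sub_right, inner_add_left,
    inner_add_right, inner_neg_right, inner_smul_left, inner_smul_right, RCLike.conj_to_real,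
    real_inner_comm x u, real_inner_comm e x]
    at h1 h2 h3' h4 h5 ⊢
  linarith [real_inner_comm x u, real_inner_comm e x]

/-- Descent lemma on a convex set, for a function that has a Lipschitz gradient only relative to
that set. -/
theorem le_quadratic_of_lipschitz_gradient {m : ℕ} {s : Set (Vec m)} (hconv : Convex ℝ s)
    {φ : Vec m → ℝ} {g : Vec m → Vec m} {L : ℝ}
    (hgrad : ∀ x ∈ s, HasGradientWithinAt φ (g x) s x)
    (hlip : ∀ x ∈ s, ∀ y ∈ s, ‖g x - g y‖ ≤ L * ‖x - y‖) {x y : Vec m} (hx : x ∈ s)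
    (hy : y ∈ s) : φ y ≤ φ x + ⟪g x, y - x⟫_ℝ + L / 2 * ‖y - x‖ ^ 2 := by
  have hmem : ∀ t ∈ Set.Icc (0 : ℝ) 1, x + t • (y - x) ∈ s := fun t ht =>
    hconv.add_smul_sub_mem hx hy ht
  have hd : ∀ t ∈ Set.Icc (0 : ℝ) 1, HasDerivWithinAt (fun t : ℝ => φ (x + t • (y - x)))
      ⟪g (x + t • (y - x)), y - x⟫_ℝ (Set.Icc 0 1) t := by
    intro t ht
    have h1 : HasDerivWithinAt (fun t : ℝ => x + t • (y - x)) (y - x) (Set.Icc 0 1) t := by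
      simpa using (((hasDerivAt_id t).smul_const (y - x)).const_add x).hasDerivWithinAt
    have h2 := (hgrad _ (hmem t ht)).hasFDerivWithinAt
    have h3 := h2.comp_hasDerivWithinAt t h1 hmem
    exact h3.congr_deriv (by simp [InnerProductSpace.toDual_apply_apply])
  have hd2 : ∀ t ∈ Set.Icc (0 : ℝ) 1, HasDerivWithinAt
      (fun t : ℝ => φ (x + t • (y - x)) - (t * ⟪g x, y - x⟫_ℝ + L / 2 * ‖y - x‖ ^ 2 * t ^ 2))
      (⟪g (x + t • (y - x)), y - x⟫_ℝ - (⟪g x, y - x⟫_ℝ + L * ‖y - x‖ ^ 2 * t))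
      (Set.Icc 0 1) t := by
    intro t ht
    refine (hd t ht).sub (HasDerivAt.hasDerivWithinAt ?_)
    have h1 := ((hasDerivAt_id t).mul_const ⟪g x, y - x⟫_ℝ).add
      ((hasDerivAt_pow 2 t).const_mul (L / 2 * ‖y - x‖ ^ 2))
    refine h1.congr_deriv ?_
    push_cast
    ring
  have hanti := antitoneOn_of_deriv_nonpos (convex_Icc (0 : ℝ) 1)
    (fun t ht => (hd2 t ht).continuousWithinAt)
    (fun t ht => ((hd2 t (interior_subset ht)).hasDerivAt
      (mem_interior_iff_mem_nhds.1 ht)).differentiableAt.differentiableWithinAt)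
    (fun t ht => by
      have ht' := interior_subset ht
      rw [((hd2 t ht').hasDerivAt (mem_interior_iff_mem_nhds.1 ht)).deriv]
      have h1 := real_inner_le_norm (g (x + t • (y - x)) - g x) (y - x)
      have h2 := hlip _ (hmem t ht') x hx
      rw [add_sub_cancel_left, norm_smul, Real.norm_of_nonneg ht'.1] at h2
      rw [inner_sub_left] at h1
      have h3 := mul_le_mul_of_nonneg_right h2 (norm_nonneg (y - x))
      nlinarith)
  have := hanti (Set.left_mem_Icc.2 zero_le_one) (Set.right_mem_Icc.2 zero_le_one) zero_le_one
  simp only [one_smul, add_sub_cancel, zero_smul, add_zero] at this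
  linarith

/-! ### Resolvents of contractions -/

section Resolvent

variable {V : Type*} [NormedAddCommGroup V] [InnerProductSpace ℝ V] {A A' : V →L[ℝ] V} {q : ℝ}

theorem one_sub_norm_le_of_contraction (hA : ‖A‖ ≤ q) (v : V) :
    (1 - q) * ‖v‖ ≤ ‖v - A v‖ := by
  have h1 : ‖A v‖ ≤ q * ‖v‖ := (A.le_opNorm v).trans (by gcongr)
  have h2 := norm_sub_norm_le v (A v)
  linarith

variable [CompleteSpace V]

theorem one_sub_apply_inverse (hA : ‖A‖ ≤ q) (hq : q < 1) (g : V) :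
    Ring.inverse (1 - A) g - A (Ring.inverse (1 - A) g) = g := by
  have h := Ring.mul_inverse_cancel (1 - A) (isUnit_one_sub_of_norm_lt_one (hA.trans_lt hq))
  simpa using congrArg (fun T : V →L[ℝ] V => T g) h

theorem norm_inverse_one_sub_apply_le (hA : ‖A‖ ≤ q) (hq : q < 1) (g : V) :
    ‖Ring.inverse (1 - A) g‖ ≤ ‖g‖ / (1 - q) := by
  rw [le_div_iff₀ (by linarith), mul_comm]
  have h := one_sub_norm_le_of_contraction hA (Ring.inverse (1 - A) g)
  rwa [one_sub_apply_inverse hA hq] at h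

/-- Perturbation of the solution of `(1 - A) v = g`: the difference `v - v'` solves
`(1 - A') (v - v') = (g - g') + (A - A') v`. -/
theorem norm_inverse_one_sub_apply_sub_le (hA : ‖A‖ ≤ q) (hA' : ‖A'‖ ≤ q) (hq : q < 1)
    (g g' : V) :
    ‖Ring.inverse (1 - A) g - Ring.inverse (1 - A') g'‖
      ≤ (‖g - g'‖ + ‖A - A'‖ * (‖g‖ / (1 - q))) / (1 - q) := by
  set v := Ring.inverse (1 - A) g with hv
  set v' := Ring.inverse (1 - A') g' with hv'
  rw [le_div_iff₀ (by linarith), mul_comm]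
  refine (one_sub_norm_le_of_contraction hA' (v - v')).trans ?_
  have e1 : v - A v = g := one_sub_apply_inverse hA hq g
  have e2 : v' - A' v' = g' := one_sub_apply_inverse hA' hq g'
  have e3 : v - v' - A' (v - v') = (g - g') + (A - A') v := by
    rw [map_sub, sub_apply, ← e1, ← e2]; abel
  rw [e3]
  refine (norm_add_le _ _).trans ?_
  gcongr
  refine ((A - A').le_opNorm v).trans ?_
  gcongr
  exact norm_inverse_one_sub_apply_le hA hq g

end Resolvent

/-! ### The solution map and the hypergradient -/

section Hypergradient

variable {d m : ℕ} {Z Ξ : Type*} [MeasurableSpace Z] [MeasurableSpace Ξ] {P : Problem d m Z Ξ}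
  {c : Constants}

namespace Problem

variable (P) in
/-- The hypergradient formula evaluated at an arbitrary lower-level point `w` instead of the
solution `w(l)`. -/
noncomputable def hypergradAt (w : Vec d) (l : Vec m) : Vec m :=
  grad2 P.E w l + ContinuousLinearMap.adjoint (D2 P.Phi w l) (P.linSol w l)

theorem Regular.differentiableAt_Phi (h : P.Regular c) {l : Vec m} (hl : l ∈ P.Lam) (w : Vec d) :
    DifferentiableAt ℝ (fun p : Vec d × Vec m => P.Phi p.1 p.2) (w, l) := by
  obtain ⟨U, hU, hsub, hPhi, -⟩ := h.diff
  exact hPhi.differentiableAt (hU.mem_nhds (hsub (Set.mk_mem_prod (Set.mem_univ w) hl)))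

theorem Regular.differentiableAt_E (h : P.Regular c) {l : Vec m} (hl : l ∈ P.Lam) (w : Vec d) :
    DifferentiableAt ℝ (fun p : Vec d × Vec m => P.E p.1 p.2) (w, l) := by
  obtain ⟨U, hU, hsub, -, hE⟩ := h.diff
  exact hE.differentiableAt (hU.mem_nhds (hsub (Set.mk_mem_prod (Set.mem_univ w) hl)))

end Problem

section Partial

variable {k : ℕ} {w : Vec d} {l : Vec m}

theorem hasFDerivAt_fst {F : Type*} [NormedAddCommGroup F] [NormedSpace ℝ F]
    {h : Vec d → Vec m → F}
    (hh : DifferentiableAt ℝ (fun p : Vec d × Vec m => h p.1 p.2) (w, l)) :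
    HasFDerivAt (fun w' => h w' l) ((fderiv ℝ (fun p : Vec d × Vec m => h p.1 p.2) (w, l)).comp
      (ContinuousLinearMap.inl ℝ (Vec d) (Vec m))) w :=
  hh.hasFDerivAt.comp (f := fun w' : Vec d => (w', l)) w (hasFDerivAt_prodMk_left w l)

theorem hasFDerivAt_snd {F : Type*} [NormedAddCommGroup F] [NormedSpace ℝ F]
    {h : Vec d → Vec m → F}
    (hh : DifferentiableAt ℝ (fun p : Vec d × Vec m => h p.1 p.2) (w, l)) :
    HasFDerivAt (fun l' => h w l') ((fderiv ℝ (fun p : Vec d × Vec m => h p.1 p.2) (w, l)).comp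
      (ContinuousLinearMap.inr ℝ (Vec d) (Vec m))) l :=
  hh.hasFDerivAt.comp (f := fun l' : Vec m => (w, l')) l (hasFDerivAt_prodMk_right w l)

theorem fderiv_prod_eq {h : Vec d → Vec m → Vec k}
    (hh : DifferentiableAt ℝ (fun p : Vec d × Vec m => h p.1 p.2) (w, l))
    (u : Vec d) (x : Vec m) :
    fderiv ℝ (fun p : Vec d × Vec m => h p.1 p.2) (w, l) (u, x) = D1 h w l u + D2 h w l x := by
  rw [D1, D2, (hasFDerivAt_fst hh).fderiv, (hasFDerivAt_snd hh).fderiv]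
  simp [← map_add]

theorem inner_grad1 {h : Vec d → Vec m → ℝ} (u : Vec d) :
    ⟪grad1 h w l, u⟫_ℝ = fderiv ℝ (fun w' => h w' l) w u := by
  rw [grad1, inner_gradient_left]

theorem inner_grad2 {h : Vec d → Vec m → ℝ} (x : Vec m) :
    ⟪grad2 h w l, x⟫_ℝ = fderiv ℝ (fun l' => h w l') l x := by
  rw [grad2, inner_gradient_left]

theorem fderiv_prod_eq_inner {h : Vec d → Vec m → ℝ}
    (hh : DifferentiableAt ℝ (fun p : Vec d × Vec m => h p.1 p.2) (w, l))
    (u : Vec d) (x : Vec m) :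
    fderiv ℝ (fun p : Vec d × Vec m => h p.1 p.2) (w, l) (u, x)
      = ⟪grad1 h w l, u⟫_ℝ + ⟪grad2 h w l, x⟫_ℝ := by
  rw [inner_grad1, inner_grad2, (hasFDerivAt_fst hh).fderiv, (hasFDerivAt_snd hh).fderiv]
  simp [← map_add]

end Partial

namespace Problem

theorem Regular.q_nonneg (h : P.Regular c) {l : Vec m} (hl : l ∈ P.Lam) : 0 ≤ c.q :=
  (norm_nonneg _).trans (h.contraction l hl 0)

theorem Regular.Phi_lower (h : P.Regular c) {l : Vec m} (hl : l ∈ P.Lam) :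
    P.Phi (P.lower l) l = P.lower l :=
  (h.fixed_iff hl _).2 rfl

theorem Regular.norm_Phi_sub_le (h : P.Regular c) {l : Vec m} (hl : l ∈ P.Lam) (x y : Vec d) :
    ‖P.Phi x l - P.Phi y l‖ ≤ c.q * ‖x - y‖ :=
  Convex.norm_image_sub_le_of_norm_fderiv_le (𝕜 := ℝ) (s := Set.univ)
    (fun z _ => (hasFDerivAt_fst (h.differentiableAt_Phi hl z)).differentiableAt)
    (fun z _ => h.contraction l hl z) convex_univ (Set.mem_univ y) (Set.mem_univ x)

theorem Regular.norm_adjoint_D1_le (h : P.Regular c) {l : Vec m} (hl : l ∈ P.Lam) (w : Vec d) :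
    ‖ContinuousLinearMap.adjoint (D1 P.Phi w l)‖ ≤ c.q := by
  rw [LinearIsometryEquiv.norm_map]
  exact h.contraction l hl w

theorem Regular.norm_grad1_le (h : P.Regular c) (hc : c.Nonneg) {l : Vec m} (hl : l ∈ P.Lam)
    (w : Vec d) : ‖grad1 P.E w l‖ ≤ c.LE := by
  have h1 : ‖fderiv ℝ (fun w' => P.E w' l) w‖ ≤ c.LE := by
    refine norm_fderiv_le_of_lip' ℝ hc.LE (Filter.Eventually.of_forall fun x => ?_)
    exact h.lip_E l hl x w
  rwa [grad1, gradient, LinearIsometryEquiv.norm_map]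

theorem Regular.norm_linSol_le (h : P.Regular c) (hc : c.Nonneg) {l : Vec m} (hl : l ∈ P.Lam)
    (w : Vec d) : ‖P.linSol w l‖ ≤ c.LE / (1 - c.q) := by
  have := h.q_lt_one
  refine (norm_inverse_one_sub_apply_le (h.norm_adjoint_D1_le hl w) h.q_lt_one _).trans ?_
  have := h.norm_grad1_le hc hl w
  gcongr

/-- Continuity of the solution map: its increments are controlled by those of `Phi(w(l), ·)`. -/
theorem Regular.norm_lower_sub_le (h : P.Regular c) {l l' : Vec m} (hl : l ∈ P.Lam)
    (hl' : l' ∈ P.Lam) :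
    (1 - c.q) * ‖P.lower l' - P.lower l‖ ≤ ‖P.Phi (P.lower l) l' - P.Phi (P.lower l) l‖ := by
  have h1 := h.norm_Phi_sub_le hl' (P.lower l') (P.lower l)
  rw [h.Phi_lower hl'] at h1
  rw [h.Phi_lower hl]
  have h2 := norm_sub_le_norm_sub_add_norm_sub (P.lower l') (P.Phi (P.lower l) l') (P.lower l)
  linarith

/-- The implicit function theorem for the solution map, relative to the feasible set. -/
theorem Regular.hasFDerivWithinAt_lower (h : P.Regular c) {l : Vec m} (hl : l ∈ P.Lam) :
    HasFDerivWithinAt P.lower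
      (Ring.inverse (1 - D1 P.Phi (P.lower l) l) ∘L D2 P.Phi (P.lower l) l) P.Lam l := by
  set w := P.lower l
  set A := D1 P.Phi w l
  set B := D2 P.Phi w l
  have hq : 0 < 1 - c.q := by linarith [h.q_lt_one]
  have hA : ‖A‖ ≤ c.q := h.contraction l hl w
  have hdiff := h.differentiableAt_Phi hl w
  have hO : (fun l' => P.lower l' - w) =O[nhdsWithin l P.Lam] fun l' => l' - l := by
    have h1 := (hasFDerivAt_snd hdiff).isBigO_sub.mono
      (nhdsWithin_le_nhds (s := P.Lam))
    refine Asymptotics.IsBigO.trans ?_ h1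
    refine Asymptotics.IsBigO.of_bound (1 / (1 - c.q)) ?_
    filter_upwards [self_mem_nhdsWithin] with l' hl'
    rw [div_mul_eq_mul_div, le_div_iff₀ hq, one_mul, mul_comm]
    exact h.norm_lower_sub_le hl hl'
  have hcont : Filter.Tendsto (fun l' => (P.lower l', l')) (nhdsWithin l P.Lam) (nhds (w, l)) := by
    refine Filter.Tendsto.prodMk_nhds ?_ (nhdsWithin_le_nhds (s := P.Lam))
    have h2 : Filter.Tendsto (fun l' => l' - l) (nhdsWithin l P.Lam) (nhds 0) := by
      have : Filter.Tendsto (fun l' => l' - l) (nhds l) (nhds (l - l)) :=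
        (continuous_id.sub continuous_const).tendsto l
      rw [sub_self] at this
      exact this.mono_left nhdsWithin_le_nhds
    simpa using (hO.trans_tendsto h2).add_const w
  have ho := (hasFDerivAt_iff_isLittleO.1 hdiff.hasFDerivAt).comp_tendsto hcont
  have hO2 : (fun l' => (P.lower l', l') - (w, l)) =O[nhdsWithin l P.Lam] fun l' => l' - l :=
    hO.prod_left (Asymptotics.isBigO_refl _ _)
  refine HasFDerivWithinAt.of_isLittleO ?_
  refine Asymptotics.IsBigO.trans_isLittleO ?_ (ho.trans_isBigO hO2)
  refine Asymptotics.IsBigO.of_bound (1 / (1 - c.q)) ?_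
  filter_upwards [self_mem_nhdsWithin] with l' hl'
  rw [div_mul_eq_mul_div, le_div_iff₀ hq, one_mul, mul_comm]
  refine (one_sub_norm_le_of_contraction hA _).trans (le_of_eq ?_)
  simp only [Function.comp_apply, Prod.mk_sub_mk]
  rw [fderiv_prod_eq hdiff, h.Phi_lower hl', h.Phi_lower hl]
  have h3 := one_sub_apply_inverse hA h.q_lt_one (B (l' - l))
  change ‖P.lower l' - w - Ring.inverse (1 - A) (B (l' - l))
    - A (P.lower l' - w - Ring.inverse (1 - A) (B (l' - l)))‖
    = ‖P.lower l' - w - (A (P.lower l' - w) + B (l' - l))‖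
  rw [map_sub A (P.lower l' - w)]
  congr 1
  linear_combination (norm := module) (-1 : ℝ) • h3

theorem Regular.lipschitz_lower (h : P.Regular c) (hup : P.UpperRegular c) {l l' : Vec m}
    (hl : l ∈ P.Lam) (hl' : l' ∈ P.Lam) :
    ‖P.lower l - P.lower l'‖ ≤ c.LPhi / (1 - c.q) * ‖l - l'‖ := by
  refine Convex.norm_image_sub_le_of_norm_hasFDerivWithin_le
    (fun x hx => h.hasFDerivWithinAt_lower hx) (fun x hx => ?_) h.convex hl' hl
  have h0 : 0 ≤ c.LPhi := (norm_nonneg _).trans (hup.bound_D2 x hx)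
  have hq : 0 < 1 - c.q := by linarith [h.q_lt_one]
  refine ContinuousLinearMap.opNorm_le_bound _ (by positivity) fun u => ?_
  refine (norm_inverse_one_sub_apply_le (h.contraction x hx _) h.q_lt_one _).trans ?_
  rw [div_mul_eq_mul_div]
  gcongr
  exact (ContinuousLinearMap.le_opNorm _ u).trans (by gcongr; exact hup.bound_D2 x hx)

/-- Implicit differentiation: the hypergradient is the gradient of `f` relative to `Lam`. -/
theorem Regular.hasGradientWithinAt_f (h : P.Regular c) {l : Vec m} (hl : l ∈ P.Lam) :
    HasGradientWithinAt P.f (P.hypergrad l) P.Lam l := by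
  have h1 : HasFDerivWithinAt (fun l' => (P.lower l', l'))
      ((Ring.inverse (1 - D1 P.Phi (P.lower l) l) ∘L D2 P.Phi (P.lower l) l).prod
        (ContinuousLinearMap.id ℝ (Vec m))) P.Lam l :=
    (h.hasFDerivWithinAt_lower hl).prodMk (hasFDerivWithinAt_id l P.Lam)
  have hE := h.differentiableAt_E hl (P.lower l)
  have h2 := HasFDerivAt.comp_hasFDerivWithinAt (g := fun p : Vec d × Vec m => P.E p.1 p.2)
    (f := fun l' => (P.lower l', l')) l hE.hasFDerivAt h1
  rw [hasGradientWithinAt_iff_hasFDerivWithinAt]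
  refine h2.congr_fderiv ?_
  ext x
  simp only [ContinuousLinearMap.comp_apply, ContinuousLinearMap.prod_apply,
    ContinuousLinearMap.id_apply, InnerProductSpace.toDual_apply_apply]
  rw [fderiv_prod_eq_inner hE, hypergrad, inner_add_left,
    ContinuousLinearMap.adjoint_inner_left, add_comm]
  congr 1
  -- `⟪∇₁E, (I - A)⁻¹ B x⟫ = ⟪(I - Aᵀ) v, (I - A)⁻¹ B x⟫ = ⟪v, B x⟫`
  have h3 := one_sub_apply_inverse (h.norm_adjoint_D1_le hl (P.lower l)) h.q_lt_one
    (grad1 P.E (P.lower l) l)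
  have h4 := one_sub_apply_inverse (h.contraction l hl (P.lower l)) h.q_lt_one
    (D2 P.Phi (P.lower l) l x)
  change _ = ⟪P.linSol (P.lower l) l, _⟫_ℝ
  change P.linSol (P.lower l) l - _ = _ at h3
  rw [← h3]
  nth_rw 2 [← h4]
  rw [inner_sub_left, inner_sub_right, ContinuousLinearMap.adjoint_inner_left]
  rfl

/-- Perturbation bound behind both the Lipschitz continuity of the hypergradient and the bias
caused by an inexact lower-level solution. -/
theorem Regular.norm_hypergradAt_sub_le (h : P.Regular c) (hc : c.Nonneg) {l l' : Vec m}
    (hl : l ∈ P.Lam) (hl' : l' ∈ P.Lam) {w w' : Vec d} {a₂ b₁ b₂ a₁ : ℝ}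
    (hw' : ‖D2 P.Phi w' l'‖ ≤ c.LPhi)
    (h₁ : ‖grad1 P.E w l - grad1 P.E w' l'‖ ≤ a₁) (h₂ : ‖grad2 P.E w l - grad2 P.E w' l'‖ ≤ a₂)
    (h₃ : ‖D1 P.Phi w l - D1 P.Phi w' l'‖ ≤ b₁) (h₄ : ‖D2 P.Phi w l - D2 P.Phi w' l'‖ ≤ b₂) :
    ‖P.hypergradAt w l - P.hypergradAt w' l'‖
      ≤ a₂ + b₂ * (c.LE / (1 - c.q))
        + c.LPhi * ((a₁ + b₁ * (c.LE / (1 - c.q))) / (1 - c.q)) := by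
  have hq : 0 < 1 - c.q := by linarith [h.q_lt_one]
  have hLE := hc.LE
  have h5 := norm_inverse_one_sub_apply_sub_le (h.norm_adjoint_D1_le hl w)
    (h.norm_adjoint_D1_le hl' w') h.q_lt_one (grad1 P.E w l) (grad1 P.E w' l')
  rw [← map_sub, LinearIsometryEquiv.norm_map] at h5
  have h6 : ‖P.linSol w l - P.linSol w' l'‖
      ≤ (a₁ + b₁ * (c.LE / (1 - c.q))) / (1 - c.q) := by
    refine h5.trans ?_
    have h7 := h.norm_grad1_le hc hl w
    have := (norm_nonneg _).trans h₃
    gcongr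
  have e : P.hypergradAt w l - P.hypergradAt w' l' = (grad2 P.E w l - grad2 P.E w' l')
      + ContinuousLinearMap.adjoint (D2 P.Phi w l - D2 P.Phi w' l') (P.linSol w l)
      + ContinuousLinearMap.adjoint (D2 P.Phi w' l') (P.linSol w l - P.linSol w' l') := by
    rw [hypergradAt, hypergradAt, map_sub, map_sub, sub_apply]
    abel
  rw [e]
  refine (norm_add₃_le).trans ?_
  have hb2 := (norm_nonneg _).trans h₄
  have hLP := (norm_nonneg _).trans hw'
  gcongr
  · refine (ContinuousLinearMap.le_opNorm _ _).trans ?_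
    rw [LinearIsometryEquiv.norm_map]
    have := h.norm_linSol_le hc hl w
    gcongr
  · refine (ContinuousLinearMap.le_opNorm _ _).trans ?_
    rw [LinearIsometryEquiv.norm_map]
    gcongr

/-- Error of the hypergradient formula caused by an inexact lower-level solution. -/
theorem Regular.norm_hypergradAt_sub_hypergrad_le (h : P.Regular c) (hc : c.Nonneg)
    (hup : P.UpperRegular c) {l : Vec m} (hl : l ∈ P.Lam) (w : Vec d) :
    ‖P.hypergradAt w l - P.hypergrad l‖ ≤ c.c1 * ‖w - P.lower l‖ := by
  refine (h.norm_hypergradAt_sub_le hc hl hl (hup.bound_D2 l hl) (h.lip_grad1 l hl _ _)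
    (h.lip_grad2 l hl _ _) (h.lip_D1 l hl _ _) (h.lip_D2 l hl _ _)).trans (le_of_eq ?_)
  have hq : 1 - c.q ≠ 0 := by linarith [h.q_lt_one]
  rw [Constants.c1]
  field_simp
  ring

/-- A function of both variables that is Lipschitz in each variable is Lipschitz along the
solution path. -/
theorem Regular.norm_sub_le_along_lower (h : P.Regular c) (hup : P.UpperRegular c)
    {F : Type*} [SeminormedAddCommGroup F] {φ : Vec d → Vec m → F} {a b : ℝ} (ha : 0 ≤ a)
    (h₁ : ∀ l ∈ P.Lam, ∀ w w', ‖φ w l - φ w' l‖ ≤ a * ‖w - w'‖)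
    (h₂ : ∀ w, ∀ l ∈ P.Lam, ∀ l' ∈ P.Lam, ‖φ w l - φ w l'‖ ≤ b * ‖l - l'‖)
    {l l' : Vec m} (hl : l ∈ P.Lam) (hl' : l' ∈ P.Lam) :
    ‖φ (P.lower l) l - φ (P.lower l') l'‖ ≤ (a * (c.LPhi / (1 - c.q)) + b) * ‖l - l'‖ := by
  have h3 := h₁ l hl (P.lower l) (P.lower l')
  have h4 := h₂ (P.lower l') l hl l' hl'
  have h5 := norm_sub_le_norm_sub_add_norm_sub (φ (P.lower l) l) (φ (P.lower l') l)
    (φ (P.lower l') l')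
  have h6 := mul_le_mul_of_nonneg_left (h.lipschitz_lower hup hl hl') ha
  linarith

theorem Regular.lipschitz_hypergrad (h : P.Regular c) (hc : c.Nonneg)
    (hup : P.UpperRegular c) {l l' : Vec m} (hl : l ∈ P.Lam) (hl' : l' ∈ P.Lam) :
    ‖P.hypergrad l - P.hypergrad l'‖ ≤ c.Lf * ‖l - l'‖ := by
  refine (h.norm_hypergradAt_sub_le hc hl hl' (hup.bound_D2 l' hl')
    (h.norm_sub_le_along_lower hup hc.mu1 h.lip_grad1 hup.lip_grad1 hl hl')
    (h.norm_sub_le_along_lower hup hc.mu2 h.lip_grad2 hup.lip_grad2 hl hl')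
    (h.norm_sub_le_along_lower hup hc.nu1 h.lip_D1 hup.lip_D1 hl hl')
    (h.norm_sub_le_along_lower hup hc.nu2 h.lip_D2 hup.lip_D2 hl hl')).trans (le_of_eq ?_)
  have hq : 1 - c.q ≠ 0 := by linarith [h.q_lt_one]
  rw [Constants.Lf, Constants.Lw']
  field_simp
  ring

end Problem

end Hypergradient

/-! ### Independent sample streams -/

/-- Bias-variance decomposition. -/
theorem lintegral_norm_add_smul_sq {Z : Type*} [MeasurableSpace Z] {n : ℕ} {μ : Measure Z}
    [IsProbabilityMeasure μ] {X : Z → Vec n} (hX : MemLp X 2 μ) (u : Vec n) (r : ℝ) :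
    ∫⁻ z, ENNReal.ofReal (‖u + r • X z‖ ^ 2) ∂μ
      = ENNReal.ofReal (‖u + r • ∫ z, X z ∂μ‖ ^ 2 + r ^ 2 * vecVar μ X) := by
  set a := ∫ z, X z ∂μ
  have hXi : Integrable X μ := hX.integrable (by norm_num)
  have hY : MemLp (fun z => X z - a) 2 μ := hX.sub (memLp_const a)
  have hYi : Integrable (fun z => X z - a) μ := hY.integrable (by norm_num)
  have hY2 : Integrable (fun z => ‖X z - a‖ ^ 2) μ := by
    simpa using hY.integrable_norm_pow (by norm_num)
  have hY0 : ∫ z, X z - a ∂μ = 0 := by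
    rw [integral_sub hXi (integrable_const a)]
    simp [a]
  have hin : Integrable (fun z => ⟪u + r • a, X z - a⟫_ℝ) μ := hYi.const_inner _
  have e : ∀ z, ‖u + r • X z‖ ^ 2
      = ‖u + r • a‖ ^ 2 + 2 * r * ⟪u + r • a, X z - a⟫_ℝ + r ^ 2 * ‖X z - a‖ ^ 2 := by
    intro z
    have e1 : u + r • X z = (u + r • a) + r • (X z - a) := by rw [smul_sub]; abel
    rw [e1, norm_add_sq_real, norm_smul, inner_smul_right, mul_pow, Real.norm_eq_abs, sq_abs]
    ring
  simp only [e]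
  have h1 : Integrable (fun z => ‖u + r • a‖ ^ 2 + 2 * r * ⟪u + r • a, X z - a⟫_ℝ) μ :=
    (integrable_const _).add (hin.const_mul _)
  have h2 : Integrable (fun z => ‖u + r • a‖ ^ 2 + 2 * r * ⟪u + r • a, X z - a⟫_ℝ
      + r ^ 2 * ‖X z - a‖ ^ 2) μ := h1.add (hY2.const_mul _)
  rw [← ofReal_integral_eq_lintegral_ofReal h2]
  · congr 1
    rw [integral_add h1 (hY2.const_mul _), integral_add (integrable_const _) (hin.const_mul _),
      integral_const_mul, integral_const_mul, integral_inner hYi, hY0, vecVar]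
    simp [a]
  · refine Filter.Eventually.of_forall fun z => ?_
    change 0 ≤ ‖u + r • a‖ ^ 2 + 2 * r * ⟪u + r • a, X z - a⟫_ℝ + r ^ 2 * ‖X z - a‖ ^ 2
    rw [← e]
    positivity

/-- Independent samples `ζ 0, ζ 1, …` of the law `μ`, where `ζ i` is revealed between times `i` and
`i + 1` of the filtration `F` and is independent of everything known at time `i`. -/
structure IsFreshStream {Ω Z : Type*} [mΩ : MeasurableSpace Ω] [MeasurableSpace Z]
    (Pr : Measure Ω) (μ : Measure Z) (F : ℕ → MeasurableSpace Ω) (ζ : ℕ → Ω → Z) : Prop where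
  le : ∀ i, F i ≤ mΩ
  mono : ∀ i, F i ≤ F (i + 1)
  meas : ∀ i, Measurable[F (i + 1)] (ζ i)
  law : ∀ i, Pr.map (ζ i) = μ
  indep : ∀ i, Indep (F i) (MeasurableSpace.comap (ζ i) inferInstance) Pr

variable {Ω Z A : Type*} [mΩ : MeasurableSpace Ω] [MeasurableSpace Z] [MeasurableSpace A]
  {Pr : Measure Ω} {μ : Measure Z} {F : ℕ → MeasurableSpace Ω} {ζ : ℕ → Ω → Z}

theorem IsFreshStream.measurable_zero (hs : IsFreshStream Pr μ F ζ) {Y : Ω → A}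
    (hY : Measurable[F 0] Y) (i : ℕ) : Measurable[F i] Y :=
  hY.mono (monotone_nat_of_le_succ hs.mono (Nat.zero_le i)) le_rfl

variable [IsProbabilityMeasure Pr] [IsProbabilityMeasure μ]

/-- A fresh sample may be integrated out with the past frozen. -/
theorem IsFreshStream.lintegral_eq (hs : IsFreshStream Pr μ F ζ) (i : ℕ) {Y : Ω → A}
    (hY : Measurable[F i] Y) {φ : A → Z → ℝ≥0∞} (hφ : Measurable fun p : A × Z => φ p.1 p.2) :
    ∫⁻ ω, φ (Y ω) (ζ i ω) ∂Pr = ∫⁻ ω, ∫⁻ z, φ (Y ω) z ∂μ ∂Pr := by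
  have hY' : Measurable Y := hY.mono (hs.le i) le_rfl
  have hζ : Measurable (ζ i) := (hs.meas i).mono (hs.le (i + 1)) le_rfl
  have hind : IndepFun Y (ζ i) Pr := by
    rw [IndepFun_iff_Indep]
    exact indep_of_indep_of_le_left (hs.indep i) hY.comap_le
  have hmap := (indepFun_iff_map_prod_eq_prod_map_map hY'.aemeasurable hζ.aemeasurable).1 hind
  rw [hs.law i] at hmap
  have := Measure.isProbabilityMeasure_map (μ := Pr) hY'.aemeasurable
  rw [← lintegral_map (f := fun p : A × Z => φ p.1 p.2) hφ (hY'.prodMk hζ), hmap,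
    lintegral_prod _ hφ.aemeasurable,
    lintegral_map (f := fun a => ∫⁻ z, φ a z ∂μ) hφ.lintegral_prod_right' hY']

/-- Second moment of a sum of centred terms that are independent given the past, weighted by a
nonnegative function of the past. -/
theorem IsFreshStream.lintegral_norm_sum_sq_le (hs : IsFreshStream Pr μ F ζ) {Y : Ω → A}
    (hY : Measurable[F 0] Y) {W : A → ℝ≥0∞} (hW : Measurable W) {n : ℕ} {h : A → Z → Vec n}
    (hh : Measurable fun p : A × Z => h p.1 p.2) {σ : A → ℝ} (hLp : ∀ a, MemLp (h a) 2 μ)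
    (hmean : ∀ a, ∫ z, h a z ∂μ = 0) (hvar : ∀ a, vecVar μ (h a) ≤ σ a) (J : ℕ) :
    Measurable[F J] (fun ω => ∑ j ∈ Finset.range J, h (Y ω) (ζ j ω)) ∧
    ∫⁻ ω, W (Y ω) * ENNReal.ofReal (‖∑ j ∈ Finset.range J, h (Y ω) (ζ j ω)‖ ^ 2) ∂Pr
      ≤ J * ∫⁻ ω, W (Y ω) * ENNReal.ofReal (σ (Y ω)) ∂Pr := by
  induction J with
  | zero => simp
  | succ J ih =>
    obtain ⟨ihm, ih⟩ := ih
    have hYJ := hs.measurable_zero hY J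
    have hYJ' := hs.measurable_zero hY (J + 1)
    refine ⟨?_, ?_⟩
    · simp only [Finset.sum_range_succ]
      refine Measurable.add (ihm.mono (hs.mono J) le_rfl) ?_
      exact hh.comp (hYJ'.prodMk (hs.meas J))
    · simp only [Finset.sum_range_succ]
      have hmeas : Measurable fun p : (A × Vec n) × Z =>
          W p.1.1 * ENNReal.ofReal (‖p.1.2 + h p.1.1 p.2‖ ^ 2) := by
        have : Measurable fun p : (A × Vec n) × Z => h p.1.1 p.2 :=
          hh.comp ((measurable_fst.comp measurable_fst).prodMk measurable_snd)
        fun_prop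
      have h1 := hs.lintegral_eq J (hYJ.prodMk ihm)
        (φ := fun p z => W p.1 * ENNReal.ofReal (‖p.2 + h p.1 z‖ ^ 2)) hmeas
      rw [h1]
      have h2 : ∀ ω, ∫⁻ z, W (Y ω) * ENNReal.ofReal
          (‖∑ j ∈ Finset.range J, h (Y ω) (ζ j ω) + h (Y ω) z‖ ^ 2) ∂μ
          ≤ W (Y ω) * ENNReal.ofReal (‖∑ j ∈ Finset.range J, h (Y ω) (ζ j ω)‖ ^ 2)
            + W (Y ω) * ENNReal.ofReal (σ (Y ω)) := by
        intro ω
        have hm : Measurable (h (Y ω)) := hh.comp measurable_prodMk_left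
        rw [lintegral_const_mul _ (by fun_prop), ← mul_add]
        gcongr
        have h3 := lintegral_norm_add_smul_sq (hLp (Y ω))
          (∑ j ∈ Finset.range J, h (Y ω) (ζ j ω)) 1
        simp only [one_smul, hmean, add_zero, one_pow, one_mul] at h3
        rw [h3]
        refine (ENNReal.ofReal_le_ofReal (add_le_add_right (hvar (Y ω)) _)).trans ?_
        exact ENNReal.ofReal_add_le
      refine (lintegral_mono h2).trans ?_
      rw [lintegral_add_left]
      · push_cast
        rw [add_mul, one_mul]
        gcongr
      · have hY' := hYJ.mono (hs.le J) le_rfl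
        have ihm' := ihm.mono (hs.le J) le_rfl
        fun_prop

/-- One step of the stochastic fixed-point iteration contracts the mean square error up to noise:
the part of the variance that grows with the residual `‖T x - x‖²` is absorbed by the averaging. -/
theorem averaged_contraction_sq_le {V : Type*} [NormedAddCommGroup V] [InnerProductSpace ℝ V]
    {x y xs : V} {q r s₁ s₂ v : ℝ} (hr : 0 ≤ r) (hr2 : r * (1 + s₂) ≤ 1)
    (hcon : ‖y - xs‖ ≤ q * ‖x - xs‖) (hv : v ≤ s₁ + s₂ * ‖y - x‖ ^ 2) :
    ‖(x - r • x - xs) + r • y‖ ^ 2 + r ^ 2 * v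
      ≤ (1 - r * (1 - q ^ 2)) * ‖x - xs‖ ^ 2 + r ^ 2 * s₁ := by
  have e1 : (x - r • x - xs) + r • y = (1 - r) • (x - xs) + r • (y - xs) := by module
  have e2 : y - x = (y - xs) - (x - xs) := by abel
  have h1 : ‖y - xs‖ ^ 2 ≤ q ^ 2 * ‖x - xs‖ ^ 2 := by
    rw [← mul_pow]; exact pow_le_pow_left₀ (norm_nonneg _) hcon 2
  have h2 : r ^ 2 * v ≤ r ^ 2 * (s₁ + s₂ * ‖y - x‖ ^ 2) := by gcongr
  have h3 : r * (r * (1 + s₂)) * ‖y - x‖ ^ 2 ≤ r * 1 * ‖y - x‖ ^ 2 := by gcongr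
  have h4 : r * ‖y - xs‖ ^ 2 ≤ r * (q ^ 2 * ‖x - xs‖ ^ 2) := by gcongr
  have e3 : ‖(1 - r) • (x - xs) + r • (y - xs)‖ ^ 2
      = (1 - r) * ‖x - xs‖ ^ 2 + r * ‖y - xs‖ ^ 2 - r * (1 - r) * ‖y - x‖ ^ 2 := by
    rw [e2, norm_add_sq_real, norm_sub_sq_real (y - xs) (x - xs), norm_smul, norm_smul, inner_smul_left,
      inner_smul_right, mul_pow, mul_pow, Real.norm_eq_abs, Real.norm_eq_abs, sq_abs, sq_abs,
      real_inner_comm (y - xs) (x - xs)]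
    simp only [RCLike.conj_to_real]
    ring
  rw [e1, e3]
  linarith

/-- Deterministic recursion behind the `O(1/i)` rate with stepsizes `β / (γ + i)`. -/
theorem robbins_monro_step {β τ N D s : ℝ} (hN : 1 ≤ N) (hD : 0 ≤ D)
    (hs : β ^ 2 * s ≤ (β * τ - 1) * D) :
    (1 - β / N * τ) * (D / N) + (β / N) ^ 2 * s ≤ D / (N + 1) := by
  have hN0 : 0 < N := by linarith
  have e : (1 - β / N * τ) * (D / N) + (β / N) ^ 2 * s
      = (N * D - β * τ * D + β ^ 2 * s) / N ^ 2 := by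
    field_simp
  rw [e, div_le_div_iff₀ (by positivity) (by positivity)]
  have h1 : N * D - β * τ * D + β ^ 2 * s ≤ (N - 1) * D := by linarith
  have h2 := mul_le_mul_of_nonneg_right h1 (show 0 ≤ N + 1 by linarith)
  nlinarith

/-- Stochastic fixed-point iteration for a `q`-contraction `T (·, a)`, where the parameter `a` is
random but known before the iteration starts: with stepsizes `β / (γ + i)` the mean square error,
weighted by a nonnegative function `W` of the parameter, is at most `D / (γ + i)`. -/
theorem IsFreshStream.lintegral_norm_iterate_sub_sq_le (hs : IsFreshStream Pr μ F ζ)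
    {Y : Ω → A} (hY : Measurable[F 0] Y) {W : A → ℝ≥0∞} (hW : Measurable W) {n : ℕ}
    {That : Vec n → A → Z → Vec n}
    (hThat : Measurable fun p : (Vec n × A) × Z => That p.1.1 p.1.2 p.2)
    {T : Vec n → A → Vec n} {xs : A → Vec n} (hxs : Measurable xs) {s₁ : A → ℝ}
    {s₂ q β γ : ℝ} (hq0 : 0 ≤ q) (hq1 : q < 1) (hs₂ : 0 ≤ s₂)
    (hLp : ∀ x a, MemLp (That x a) 2 μ) (hmean : ∀ x a, ∫ z, That x a z ∂μ = T x a)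
    (hvar : ∀ x a, vecVar μ (That x a) ≤ s₁ a + s₂ * ‖T x a - x‖ ^ 2)
    (hcon : ∀ x a, ‖T x a - xs a‖ ≤ q * ‖x - xs a‖)
    {x : ℕ → Ω → Vec n} {η : ℕ → ℝ} (hη : ∀ j, η j = β / (γ + j)) (hx0 : ∀ ω, x 0 ω = 0)
    (hx : ∀ i ω, x (i + 1) ω = x i ω + η i • (That (x i ω) (Y ω) (ζ i ω) - x i ω))
    (hβ : 1 < β * (1 - q ^ 2)) (hγ : β * (1 + s₂) ≤ γ) {D s : ℝ} (hD : 0 ≤ D) (hs0 : 0 ≤ s)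
    (hD0 : ∫⁻ ω, W (Y ω) * ENNReal.ofReal (‖xs (Y ω)‖ ^ 2) ∂Pr ≤ ENNReal.ofReal (D / γ))
    (hs1 : ∫⁻ ω, W (Y ω) * ENNReal.ofReal (s₁ (Y ω)) ∂Pr ≤ ENNReal.ofReal s)
    (hsD : β ^ 2 * s ≤ (β * (1 - q ^ 2) - 1) * D) (i : ℕ) :
    Measurable[F i] (x i) ∧
    ∫⁻ ω, W (Y ω) * ENNReal.ofReal (‖x i ω - xs (Y ω)‖ ^ 2) ∂Pr
      ≤ ENNReal.ofReal (D / (γ + i)) := by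
  have hτ1 : 1 - q ^ 2 ≤ 1 := by nlinarith
  have hτ0 : 0 < 1 - q ^ 2 := by nlinarith
  have hβ0 : 1 < β := by
    by_contra! hcontra
    have := mul_le_mul_of_nonneg_right hcontra hτ0.le
    linarith
  have hγ0 : 1 < γ := by nlinarith
  induction i with
  | zero =>
    refine ⟨?_, ?_⟩
    · have : x 0 = fun _ => 0 := funext hx0
      rw [this]
      exact measurable_const
    · simpa [hx0] using hD0
  | succ i ih =>
    obtain ⟨ihm, ih⟩ := ih
    have hYi := hs.measurable_zero hY i
    have hYi' := hs.measurable_zero hY (i + 1)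
    have hN : 1 < γ + i := by
      have : (0 : ℝ) ≤ i := Nat.cast_nonneg i
      linarith
    have hr0 : 0 ≤ η i := by rw [hη]; positivity
    have hr1 : η i * (1 + s₂) ≤ 1 := by
      rw [hη, div_mul_eq_mul_div, div_le_one (by linarith)]
      have : (0 : ℝ) ≤ i := Nat.cast_nonneg i
      linarith
    have hr2 : 0 ≤ 1 - η i * (1 - q ^ 2) := by nlinarith
    refine ⟨?_, ?_⟩
    · have e : x (i + 1) = fun ω => x i ω + η i • (That (x i ω) (Y ω) (ζ i ω) - x i ω) :=
        funext (hx i)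
      rw [e]
      have h1 : Measurable[F (i + 1)] (x i) := ihm.mono (hs.mono i) le_rfl
      have h2 : Measurable[F (i + 1)] fun ω => That (x i ω) (Y ω) (ζ i ω) :=
        hThat.comp ((h1.prodMk hYi').prodMk (hs.meas i))
      exact h1.add ((h2.sub h1).const_smul (η i))
    · have hmeas : Measurable fun p : (Vec n × A) × Z => W p.1.2 * ENNReal.ofReal
          (‖p.1.1 + η i • (That p.1.1 p.1.2 p.2 - p.1.1) - xs p.1.2‖ ^ 2) := by
        have hx1 : Measurable fun p : (Vec n × A) × Z => p.1.1 := by fun_prop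
        have hx2 : Measurable fun p : (Vec n × A) × Z => xs p.1.2 := by fun_prop
        have hx3 := (hx1.add ((hThat.sub hx1).const_smul (η i))).sub hx2
        have hx4 : Measurable fun p : (Vec n × A) × Z => W p.1.2 := by fun_prop
        exact hx4.mul (hx3.norm.pow_const 2).ennreal_ofReal
      have h1 := hs.lintegral_eq i (ihm.prodMk hYi) (φ := fun p z => W p.2 * ENNReal.ofReal
          (‖p.1 + η i • (That p.1 p.2 z - p.1) - xs p.2‖ ^ 2)) hmeas
      simp only [hx]
      rw [h1]
      have h2 : ∀ ω, ∫⁻ z, W (Y ω) * ENNReal.ofReal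
          (‖x i ω + η i • (That (x i ω) (Y ω) z - x i ω) - xs (Y ω)‖ ^ 2) ∂μ
          ≤ ENNReal.ofReal (1 - η i * (1 - q ^ 2))
              * (W (Y ω) * ENNReal.ofReal (‖x i ω - xs (Y ω)‖ ^ 2))
            + ENNReal.ofReal (η i ^ 2) * (W (Y ω) * ENNReal.ofReal (s₁ (Y ω))) := by
        intro ω
        have hm : Measurable (That (x i ω) (Y ω)) :=
          hThat.comp (measurable_prodMk_left (x := (x i ω, Y ω)))
        rw [lintegral_const_mul _ (by fun_prop), mul_left_comm, mul_left_comm _ (W (Y ω)),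
          ← mul_add]
        gcongr
        have e : ∀ z, x i ω + η i • (That (x i ω) (Y ω) z - x i ω) - xs (Y ω)
            = (x i ω - η i • x i ω - xs (Y ω)) + η i • That (x i ω) (Y ω) z := fun z => by module
        simp only [e]
        rw [lintegral_norm_add_smul_sq (hLp _ _), hmean, ← ENNReal.ofReal_mul hr2,
          ← ENNReal.ofReal_mul (sq_nonneg _)]
        refine (ENNReal.ofReal_le_ofReal ?_).trans ENNReal.ofReal_add_le
        exact averaged_contraction_sq_le hr0 hr1 (hcon _ _) (hvar _ _)
      refine (lintegral_mono h2).trans ?_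
      rw [lintegral_add_left, lintegral_const_mul' _ _ ENNReal.ofReal_ne_top,
        lintegral_const_mul' _ _ ENNReal.ofReal_ne_top]
      · refine (add_le_add (mul_le_mul_right ih _) (mul_le_mul_right hs1 _)).trans ?_
        rw [← ENNReal.ofReal_mul hr2, ← ENNReal.ofReal_mul (sq_nonneg _),
          ← ENNReal.ofReal_add (by positivity) (by positivity)]
        refine ENNReal.ofReal_le_ofReal ?_
        have := robbins_monro_step hN.le hD hsD
        rw [← hη] at this
        push_cast
        rwa [← add_assoc]
      · have hY' := hYi.mono (hs.le i) le_rfl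
        have ihm' := ihm.mono (hs.le i) le_rfl
        fun_prop

/-! ### Measurability and moments of the oracles -/

theorem measurable_of_inner {α : Type*} [MeasurableSpace α] {n : ℕ} {F : α → Vec n}
    (h : ∀ u, Measurable fun a => ⟪F a, u⟫_ℝ) : Measurable F := by
  have e : F = fun a => ∑ i, ⟪F a, EuclideanSpace.basisFun (Fin n) ℝ i⟫_ℝ •
      EuclideanSpace.basisFun (Fin n) ℝ i := by
    funext a
    conv_lhs => rw [← (EuclideanSpace.basisFun (Fin n) ℝ).sum_repr' (F a)]
    simp only [real_inner_comm]
  rw [e]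
  exact Finset.measurable_sum _ fun i _ => (h _).smul_const _

/-- Directional derivatives of a jointly measurable function are jointly measurable, as limits of
difference quotients. -/
theorem measurable_fderiv_prod {d m : ℕ} {Z : Type*} [MeasurableSpace Z] {S : Set (Vec m)}
    {F : Type*} [NormedAddCommGroup F] [NormedSpace ℝ F] [MeasurableSpace F] [BorelSpace F]
    [SecondCountableTopology F] {h : Vec d → Vec m → Z → F}
    (hm : Measurable fun p : (Vec d × Vec m) × Z => h p.1.1 p.1.2 p.2)
    (hd : ∀ z w, ∀ l ∈ S, DifferentiableAt ℝ (fun p : Vec d × Vec m => h p.1 p.2 z) (w, l))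
    (u : Vec d × Vec m) :
    Measurable fun p : (Vec d × S) × Z =>
      fderiv ℝ (fun q : Vec d × Vec m => h q.1 q.2 p.2) (p.1.1, p.1.2) u := by
  have hlim := fun p : (Vec d × S) × Z =>
    (hd p.2 p.1.1 p.1.2 p.1.2.2).hasFDerivAt.lim (l := Filter.atTop) u
      (c := fun n : ℕ => (n : ℝ)) (by
        simpa using tendsto_natCast_atTop_atTop (R := ℝ))
  refine measurable_of_tendsto_metrizable (fun n => ?_) (tendsto_pi_nhds.2 hlim)
  have h1 : Measurable fun p : (Vec d × S) × Z => (((p.1.1, (p.1.2 : Vec m)), p.2) :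
    (Vec d × Vec m) × Z) := by fun_prop
  have h2 : Measurable fun p : (Vec d × S) × Z => ((((p.1.1, (p.1.2 : Vec m)) +
    (n : ℝ)⁻¹ • u), p.2) : (Vec d × Vec m) × Z) := by fun_prop
  exact ((hm.comp h2).sub (hm.comp h1)).const_smul (n : ℝ)

/-- `A ↦ Aᵀ v` as a continuous linear map. -/
noncomputable def adjointApply {a b : ℕ} (v : Vec b) : (Vec a →L[ℝ] Vec b) →L[ℝ] Vec a :=
  LinearMap.mkContinuous
    { toFun := fun A => ContinuousLinearMap.adjoint A v
      map_add' := fun A B => by simp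
      map_smul' := fun r A => by simp } ‖v‖ fun A => by
    have h := (ContinuousLinearMap.adjoint A).le_opNorm v
    rw [LinearIsometryEquiv.norm_map, mul_comm] at h
    exact h

@[simp] theorem adjointApply_apply {a b : ℕ} (v : Vec b) (A : Vec a →L[ℝ] Vec b) :
    adjointApply v A = ContinuousLinearMap.adjoint A v := rfl

theorem norm_adjoint_apply_le {a b : ℕ} (v : Vec b) (A : Vec a →L[ℝ] Vec b) :
    ‖ContinuousLinearMap.adjoint A v‖ ≤ ‖A‖ * ‖v‖ := by
  refine (ContinuousLinearMap.le_opNorm _ v).trans (le_of_eq ?_)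
  rw [LinearIsometryEquiv.norm_map]

section Moments

variable {Z : Type*} [MeasurableSpace Z] {μ : Measure Z} [IsProbabilityMeasure μ] {n k : ℕ}
  {D : Z → Vec n →L[ℝ] Vec k}

theorem memLp_adjoint_add (hD : MemLp D 2 μ) (v : Vec k) (g : Vec n) :
    MemLp (fun z => ContinuousLinearMap.adjoint (D z) v + g) 2 μ :=
  ((adjointApply v).comp_memLp' hD).add (memLp_const g)

theorem integral_adjoint_add (hD : MemLp D 2 μ) (v : Vec k) (g : Vec n) :
    ∫ z, (ContinuousLinearMap.adjoint (D z) v + g) ∂μ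
      = ContinuousLinearMap.adjoint (∫ z, D z ∂μ) v + g := by
  have h1 : Integrable (fun z => adjointApply v (D z)) μ :=
    ((adjointApply v).comp_memLp' hD).integrable (by norm_num)
  have h2 := (adjointApply v).integral_comp_comm (hD.integrable (by norm_num))
  simp only [adjointApply_apply] at h1 h2
  rw [integral_add h1 (integrable_const g), h2]
  simp

theorem vecVar_adjoint_add_le (hD : MemLp D 2 μ) (v : Vec k) (g : Vec n) :
    vecVar μ (fun z => ContinuousLinearMap.adjoint (D z) v + g) ≤ ‖v‖ ^ 2 * vecVar μ D := by
  rw [vecVar, integral_adjoint_add hD, vecVar, ← integral_const_mul]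
  have e : ∀ z, ContinuousLinearMap.adjoint (D z) v + g
      - (ContinuousLinearMap.adjoint (∫ z, D z ∂μ) v + g)
      = ContinuousLinearMap.adjoint (D z - ∫ z, D z ∂μ) v := fun z => by
    rw [map_sub, sub_apply]; abel
  have h1 : MemLp (fun z => D z - ∫ z, D z ∂μ) 2 μ := hD.sub (memLp_const _)
  have h2 : Integrable (fun z => ‖D z - ∫ z, D z ∂μ‖ ^ 2) μ := by
    simpa using h1.integrable_norm_pow (by norm_num)
  have h3 : Integrable (fun z => ‖ContinuousLinearMap.adjoint (D z - ∫ z, D z ∂μ) v‖ ^ 2) μ := by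
    simpa using ((adjointApply v).comp_memLp' h1).integrable_norm_pow (by norm_num)
  simp only [e]
  refine integral_mono h3 (h2.const_mul _) fun z => ?_
  change ‖ContinuousLinearMap.adjoint (D z - ∫ z, D z ∂μ) v‖ ^ 2
    ≤ ‖v‖ ^ 2 * ‖D z - ∫ z, D z ∂μ‖ ^ 2
  rw [← mul_pow, mul_comm ‖v‖]
  exact pow_le_pow_left₀ (norm_nonneg _) (norm_adjoint_apply_le _ _) 2

theorem memLp_sub_const {X : Z → Vec n} (hX : MemLp X 2 μ) (a : Vec n) :
    MemLp (fun z => X z - a) 2 μ := hX.sub (memLp_const a)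

theorem integral_sub_mean {X : Z → Vec n} (hX : MemLp X 2 μ) :
    ∫ z, (X z - ∫ z, X z ∂μ) ∂μ = 0 := by
  rw [integral_sub (hX.integrable (by norm_num)) (integrable_const _)]
  simp

theorem vecVar_sub_mean {X : Z → Vec n} (hX : MemLp X 2 μ) :
    vecVar μ (fun z => X z - ∫ z, X z ∂μ) = vecVar μ X := by
  rw [vecVar, integral_sub_mean hX]
  simp [vecVar]

end Moments

namespace Problem

variable {d m : ℕ} {Z Ξ : Type*} [MeasurableSpace Z] [MeasurableSpace Ξ] {P : Problem d m Z Ξ}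
  {c : Constants}

theorem Oracle.differentiableAt_Phihat (h : P.Oracle c) (z : Z) (w : Vec d) (l : Vec m)
    (hl : l ∈ P.Lam) :
    DifferentiableAt ℝ (fun p : Vec d × Vec m => P.Phihat p.1 p.2 z) (w, l) := by
  obtain ⟨U, hU, hsub, hd⟩ := h.diff_Phihat z
  exact hd.differentiableAt (hU.mem_nhds (hsub (Set.mk_mem_prod (Set.mem_univ w) hl)))

theorem Oracle.differentiableAt_Ehat (h : P.Oracle c) (x : Ξ) (w : Vec d) (l : Vec m)
    (hl : l ∈ P.Lam) :
    DifferentiableAt ℝ (fun p : Vec d × Vec m => P.Ehat p.1 p.2 x) (w, l) := by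
  obtain ⟨U, hU, hsub, hd⟩ := h.diff_Ehat x
  exact hd.differentiableAt (hU.mem_nhds (hsub (Set.mk_mem_prod (Set.mem_univ w) hl)))

theorem Oracle.measurable_Phihat (h : P.Oracle c) :
    Measurable fun p : (Vec d × P.Lam) × Z => P.Phihat p.1.1 p.1.2 p.2 := by
  have h1 : Measurable fun p : (Vec d × P.Lam) × Z => (((p.1.1, (p.1.2 : Vec m)), p.2) :
    (Vec d × Vec m) × Z) := by fun_prop
  exact h.meas_Phihat.comp h1

theorem Oracle.measurable_adjoint_D1 (h : P.Oracle c) :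
    Measurable fun p : ((Vec d × P.Lam) × Vec d) × Z =>
      ContinuousLinearMap.adjoint (D1 (fun w l => P.Phihat w l p.2) p.1.1.1 p.1.1.2) p.1.2 := by
  refine measurable_of_inner fun u => ?_
  have h1 := measurable_fderiv_prod (S := P.Lam) h.meas_Phihat h.differentiableAt_Phihat (u, 0)
  have h2 : Measurable fun p : ((Vec d × P.Lam) × Vec d) × Z => (p.1.1, p.2) := by fun_prop
  have h3 : Measurable fun p : ((Vec d × P.Lam) × Vec d) × Z => p.1.2 := by fun_prop
  have e : (fun p : ((Vec d × P.Lam) × Vec d) × Z => ⟪ContinuousLinearMap.adjoint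
      (D1 (fun w l => P.Phihat w l p.2) p.1.1.1 p.1.1.2) p.1.2, u⟫_ℝ)
      = fun p => ⟪p.1.2, fderiv ℝ (fun q : Vec d × Vec m => P.Phihat q.1 q.2 p.2)
        (p.1.1.1, p.1.1.2) (u, 0)⟫_ℝ := by
    funext p
    rw [ContinuousLinearMap.adjoint_inner_left,
      fderiv_prod_eq (h := fun w l => P.Phihat w l p.2)
        (h.differentiableAt_Phihat _ _ _ p.1.1.2.2), map_zero, add_zero]
  rw [e]
  exact h3.inner (𝕜 := ℝ) (h1.comp h2)

theorem Oracle.measurable_adjoint_D2 (h : P.Oracle c) :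
    Measurable fun p : ((Vec d × P.Lam) × Vec d) × Z =>
      ContinuousLinearMap.adjoint (D2 (fun w l => P.Phihat w l p.2) p.1.1.1 p.1.1.2) p.1.2 := by
  refine measurable_of_inner fun u => ?_
  have h1 := measurable_fderiv_prod (S := P.Lam) h.meas_Phihat h.differentiableAt_Phihat (0, u)
  have h2 : Measurable fun p : ((Vec d × P.Lam) × Vec d) × Z => (p.1.1, p.2) := by fun_prop
  have h3 : Measurable fun p : ((Vec d × P.Lam) × Vec d) × Z => p.1.2 := by fun_prop
  have e : (fun p : ((Vec d × P.Lam) × Vec d) × Z => ⟪ContinuousLinearMap.adjoint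
      (D2 (fun w l => P.Phihat w l p.2) p.1.1.1 p.1.1.2) p.1.2, u⟫_ℝ)
      = fun p => ⟪p.1.2, fderiv ℝ (fun q : Vec d × Vec m => P.Phihat q.1 q.2 p.2)
        (p.1.1.1, p.1.1.2) (0, u)⟫_ℝ := by
    funext p
    rw [ContinuousLinearMap.adjoint_inner_left,
      fderiv_prod_eq (h := fun w l => P.Phihat w l p.2)
        (h.differentiableAt_Phihat _ _ _ p.1.1.2.2), map_zero, zero_add]
  rw [e]
  exact h3.inner (𝕜 := ℝ) (h1.comp h2)

theorem Oracle.measurable_grad1 (h : P.Oracle c) :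
    Measurable fun p : (Vec d × P.Lam) × Ξ =>
      grad1 (fun w l => P.Ehat w l p.2) p.1.1 p.1.2 := by
  refine measurable_of_inner fun u => ?_
  convert measurable_fderiv_prod (S := P.Lam) h.meas_Ehat h.differentiableAt_Ehat (u, 0)
    using 2 with p
  rw [fderiv_prod_eq_inner (h := fun w l => P.Ehat w l p.2)
    (h.differentiableAt_Ehat _ _ _ p.1.2.2), inner_zero_right, add_zero]

theorem Oracle.measurable_grad2 (h : P.Oracle c) :
    Measurable fun p : (Vec d × P.Lam) × Ξ =>
      grad2 (fun w l => P.Ehat w l p.2) p.1.1 p.1.2 := by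
  refine measurable_of_inner fun u => ?_
  convert measurable_fderiv_prod (S := P.Lam) h.meas_Ehat h.differentiableAt_Ehat (0, u)
    using 2 with p
  rw [fderiv_prod_eq_inner (h := fun w l => P.Ehat w l p.2)
    (h.differentiableAt_Ehat _ _ _ p.1.2.2), inner_zero_right, zero_add]

/-! ### Continuity of the exact quantities -/

theorem continuous_of_lipschitz_each {F : Type*} [SeminormedAddCommGroup F]
    {φ : Vec d → Vec m → F} {S : Set (Vec m)} {a b : ℝ}
    (h₁ : ∀ l ∈ S, ∀ w w', ‖φ w l - φ w' l‖ ≤ a * ‖w - w'‖)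
    (h₂ : ∀ w, ∀ l ∈ S, ∀ l' ∈ S, ‖φ w l - φ w l'‖ ≤ b * ‖l - l'‖) :
    Continuous fun p : Vec d × S => φ p.1 p.2 := by
  refine continuous_iff_continuousAt.2 fun p => ?_
  refine tendsto_iff_norm_sub_tendsto_zero.2 ?_
  have hlim : Filter.Tendsto (fun r : Vec d × S =>
      a * ‖r.1 - p.1‖ + b * ‖(r.2 : Vec m) - p.2‖) (nhds p) (nhds 0) := by
    have : Continuous fun r : Vec d × S => a * ‖r.1 - p.1‖ + b * ‖(r.2 : Vec m) - p.2‖ := by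
      fun_prop
    simpa using this.tendsto p
  refine squeeze_zero (fun _ => norm_nonneg _) (fun r => ?_) hlim
  exact (norm_sub_le_norm_sub_add_norm_sub _ (φ p.1 r.2) _).trans
    (add_le_add (h₁ _ r.2.2 _ _) (h₂ _ _ r.2.2 _ p.2.2))

theorem Regular.continuous_lower (h : P.Regular c) :
    Continuous fun l : P.Lam => P.lower l := by
  refine continuous_iff_continuousAt.2 fun l => ?_
  have := (h.hasFDerivWithinAt_lower l.2).continuousWithinAt
  exact continuousWithinAt_iff_continuousAt_domRestrict _ l.2 |>.1 this

/-- The solution of the linear system `(I - ∂₁Phi(w,l)ᵀ) v = g` depends continuously on all data. -/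
theorem Regular.continuous_inverse_apply (h : P.Regular c) (hup : P.UpperRegular c) :
    Continuous fun p : (Vec d × P.Lam) × Vec d =>
      Ring.inverse (1 - ContinuousLinearMap.adjoint (D1 P.Phi p.1.1 p.1.2)) p.2 := by
  have h1 : Continuous fun p : Vec d × P.Lam =>
      Ring.inverse (1 - ContinuousLinearMap.adjoint (D1 P.Phi p.1 p.2)) := by
    have h0 := continuous_of_lipschitz_each h.lip_D1 hup.lip_D1
    have h2 : Continuous fun p : Vec d × P.Lam =>
        1 - ContinuousLinearMap.adjoint (D1 P.Phi p.1 p.2) :=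
      continuous_const.sub (ContinuousLinearMap.adjoint.continuous.comp h0)
    refine continuous_iff_continuousAt.2 fun p => ?_
    obtain ⟨u, hu⟩ := isUnit_one_sub_of_norm_lt_one
      ((h.norm_adjoint_D1_le p.2.2 p.1).trans_lt h.q_lt_one)
    have h3 := NormedRing.inverse_continuousAt u
    rw [hu] at h3
    exact ContinuousAt.comp (g := Ring.inverse) h3 h2.continuousAt
  exact (h1.comp continuous_fst).clm_apply continuous_snd

theorem Regular.continuous_hypergradAt (h : P.Regular c) (hup : P.UpperRegular c) :
    Continuous fun p : Vec d × P.Lam => P.hypergradAt p.1 p.2 := by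
  have h1 := continuous_of_lipschitz_each h.lip_grad1 hup.lip_grad1
  have h2 := continuous_of_lipschitz_each h.lip_grad2 hup.lip_grad2
  have h3 := continuous_of_lipschitz_each h.lip_D2 hup.lip_D2
  have h4 := (h.continuous_inverse_apply hup).comp (continuous_id.prodMk h1)
  have h5 : Continuous fun p : Vec d × P.Lam =>
      ContinuousLinearMap.adjoint (D2 P.Phi p.1 p.2) :=
    ContinuousLinearMap.adjoint.continuous.comp h3
  exact h2.add (h5.clm_apply h4)

theorem Regular.continuous_hypergrad (h : P.Regular c) (hup : P.UpperRegular c) :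
    Continuous fun l : P.Lam => P.hypergrad l :=
  (h.continuous_hypergradAt hup).comp (h.continuous_lower.prodMk continuous_id)

end Problem

/-! ### Mean square error of stochastic implicit differentiation -/

theorem lintegral_le_of_le_mul_add {Ω : Type*} [MeasurableSpace Ω] {Pr : Measure Ω}
    {f g₁ g₂ : Ω → ℝ≥0∞} {k b₁ b₂ : ℝ} (hk : 0 ≤ k) (hb₁ : 0 ≤ b₁) (hb₂ : 0 ≤ b₂)
    (hm : Measurable g₁) (h : ∀ ω, f ω ≤ ENNReal.ofReal k * g₁ ω + g₂ ω)
    (h₁ : ∫⁻ ω, g₁ ω ∂Pr ≤ ENNReal.ofReal b₁) (h₂ : ∫⁻ ω, g₂ ω ∂Pr ≤ ENNReal.ofReal b₂) :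
    ∫⁻ ω, f ω ∂Pr ≤ ENNReal.ofReal (k * b₁ + b₂) := by
  refine (lintegral_mono h).trans ?_
  rw [lintegral_add_left (hm.const_mul _), lintegral_const_mul' _ _ ENNReal.ofReal_ne_top,
    ENNReal.ofReal_add (by positivity) hb₂, ENNReal.ofReal_mul hk]
  gcongr

theorem lintegral_le_of_le_mul {Ω : Type*} [MeasurableSpace Ω] {Pr : Measure Ω}
    {f g : Ω → ℝ≥0∞} {k b : ℝ} (hk : 0 ≤ k)
    (h : ∀ ω, f ω ≤ ENNReal.ofReal k * g ω) (h₁ : ∫⁻ ω, g ω ∂Pr ≤ ENNReal.ofReal b) :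
    ∫⁻ ω, f ω ∂Pr ≤ ENNReal.ofReal (k * b) := by
  refine (lintegral_mono h).trans ?_
  rw [lintegral_const_mul' _ _ ENNReal.ofReal_ne_top, ENNReal.ofReal_mul hk]
  gcongr

theorem norm_add_sq_le_two_mul {V : Type*} [SeminormedAddCommGroup V] (x y : V) :
    ‖x + y‖ ^ 2 ≤ 2 * ‖x‖ ^ 2 + 2 * ‖y‖ ^ 2 := by
  have h1 := norm_add_le x y
  have h2 := pow_le_pow_left₀ (norm_nonneg _) h1 2
  nlinarith [sq_nonneg (‖x‖ - ‖y‖)]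

/-- Weighted mean square error of a mini-batch average of samples that are unbiased for `T (Y ω)`
given the past. -/
theorem IsFreshStream.lintegral_norm_average_sub_sq_le {Ω Z A : Type*} [MeasurableSpace Ω]
    [MeasurableSpace Z] [MeasurableSpace A] {Pr : Measure Ω} [IsProbabilityMeasure Pr]
    {μ : Measure Z} [IsProbabilityMeasure μ] {F : ℕ → MeasurableSpace Ω} {ζ : ℕ → Ω → Z}
    (hs : IsFreshStream Pr μ F ζ) {Y : Ω → A}
    (hY : Measurable[F 0] Y) {W : A → ℝ≥0∞} (hW : Measurable W) {n : ℕ} {h : A → Z → Vec n}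
    (hh : Measurable fun p : A × Z => h p.1 p.2) {T : A → Vec n} (hT : Measurable T)
    {σ : A → ℝ} (hLp : ∀ a, MemLp (h a) 2 μ) (hmean : ∀ a, ∫ z, h a z ∂μ = T a)
    (hvar : ∀ a, vecVar μ (h a) ≤ σ a) {K : ℝ}
    (hK : ∫⁻ ω, W (Y ω) * ENNReal.ofReal (σ (Y ω)) ∂Pr ≤ ENNReal.ofReal K) {J : ℕ}
    (hJ : 1 ≤ J) :
    Measurable[F J] (fun ω => (J : ℝ)⁻¹ • ∑ j ∈ Finset.range J, h (Y ω) (ζ j ω)) ∧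
    ∫⁻ ω, W (Y ω) * ENNReal.ofReal
      (‖(J : ℝ)⁻¹ • ∑ j ∈ Finset.range J, h (Y ω) (ζ j ω) - T (Y ω)‖ ^ 2) ∂Pr
      ≤ ENNReal.ofReal (K / J) := by
  have hJ0 : (0 : ℝ) < J := by exact_mod_cast hJ
  obtain ⟨h1, h2⟩ := hs.lintegral_norm_sum_sq_le hY hW (h := fun a z => h a z - T a)
    (hh.sub (hT.comp measurable_fst)) (σ := σ) (fun a => memLp_sub_const (hLp a) _)
    (fun a => by rw [← hmean a]; exact integral_sub_mean (hLp a))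
    (fun a => by rw [← hmean a, vecVar_sub_mean (hLp a)]; exact hvar a) J
  have e : ∀ ω, (J : ℝ)⁻¹ • ∑ j ∈ Finset.range J, h (Y ω) (ζ j ω) = T (Y ω)
      + (J : ℝ)⁻¹ • ∑ j ∈ Finset.range J, (h (Y ω) (ζ j ω) - T (Y ω)) := fun ω => by
    rw [Finset.sum_sub_distrib, smul_sub, Finset.sum_const, Finset.card_range,
      ← Nat.cast_smul_eq_nsmul ℝ, smul_smul, inv_mul_cancel₀ hJ0.ne', one_smul]
    abel
  refine ⟨?_, ?_⟩
  · simp only [e]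
    exact (hT.comp (hs.measurable_zero hY J)).add (h1.const_smul (J : ℝ)⁻¹)
  · have h3 : ∫⁻ ω, W (Y ω) * ENNReal.ofReal (‖∑ j ∈ Finset.range J,
        (h (Y ω) (ζ j ω) - T (Y ω))‖ ^ 2) ∂Pr ≤ ENNReal.ofReal (J * K) := by
      rw [ENNReal.ofReal_mul hJ0.le, ENNReal.ofReal_natCast]
      exact h2.trans (by gcongr)
    refine (lintegral_le_of_le_mul (k := ((J : ℝ)⁻¹) ^ 2) (by positivity) (fun ω => ?_)
      h3).trans (le_of_eq ?_)
    · rw [e, add_sub_cancel_left, norm_smul, mul_pow, Real.norm_of_nonneg (by positivity),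
        ENNReal.ofReal_mul (by positivity), mul_left_comm]
    · congr 1
      field_simp

section ConstantsFacts

variable {c : Constants} {β γ : ℝ}

theorem Constants.one_lt_mul (hq0 : 0 ≤ c.q) (hq1 : c.q < 1) (hβ : 1 / (1 - c.q ^ 2) < β) :
    1 < β * (1 - c.q ^ 2) := by
  rwa [div_lt_iff₀ (by nlinarith)] at hβ

theorem Constants.sigTilde2_nonneg (hc : c.Nonneg) : 0 ≤ c.sigTilde2 :=
  hc.sig2.trans (le_max_right _ _)

theorem Constants.one_lt_beta (hq0 : 0 ≤ c.q) (hq1 : c.q < 1) (hβ : 1 / (1 - c.q ^ 2) < β) :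
    1 < β := by
  have h1 := c.one_lt_mul hq0 hq1 hβ
  by_contra! hcontra
  nlinarith [mul_le_mul_of_nonneg_right hcontra (show 0 ≤ 1 - c.q ^ 2 by nlinarith)]

theorem Constants.one_lt_gamma (hc : c.Nonneg) (hq0 : 0 ≤ c.q) (hq1 : c.q < 1)
    (hβ : 1 / (1 - c.q ^ 2) < β) (hγ : β * (1 + c.sigTilde2) ≤ γ) : 1 < γ := by
  have h1 := c.one_lt_beta hq0 hq1 hβ
  have h2 := c.sigTilde2_nonneg hc
  nlinarith

theorem Constants.dw_nonneg (hγ : 0 ≤ γ) : 0 ≤ c.dw β γ :=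
  (by positivity : (0 : ℝ) ≤ γ * c.B ^ 2).trans (le_max_left _ _)

theorem Constants.dv_nonneg (hc : c.Nonneg) (hγ : 0 ≤ γ) : 0 ≤ c.dv β γ := by
  have := hc.sigE1
  exact (by positivity : (0 : ℝ) ≤ (c.LE ^ 2 + c.sigE1) / (1 - c.q) ^ 2 * γ).trans
    (le_max_left _ _)

theorem Constants.cb_add_cv_nonneg (hc : c.Nonneg) (hγ : 0 ≤ γ) :
    0 ≤ c.cb β γ + c.cv β γ := by
  have h1 := c.dw_nonneg (β := β) hγ
  have h2 := c.dv_nonneg (β := β) hc hγ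
  have := hc.sigE1
  have := hc.sigE2
  have := hc.sig2'
  rw [Constants.cb, Constants.cv]
  positivity

end ConstantsFacts

section MeanSquareError

variable {d m : ℕ} {Z Ξ Ω : Type*} [MeasurableSpace Z] [MeasurableSpace Ξ]
  [mΩ : MeasurableSpace Ω] {Pr : Measure Ω} [IsProbabilityMeasure Pr] {P : Problem d m Z Ξ}
  {c : Constants} {β γ : ℝ} {η : ℕ → ℝ}

/-- Mean square error of the lower-level solver, started at `0`, at a random parameter `L` that is
independent of its samples. -/
theorem lintegral_llSolver_sub_sq_le (hc : c.Nonneg) (hreg : P.Regular c)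
    (hup : P.UpperRegular c) (horacle : P.Oracle c) (hβ : 1 / (1 - c.q ^ 2) < β)
    (hγ : β * (1 + c.sigTilde2) ≤ γ) (hη : ∀ j, η j = β / (γ + j)) (hq0 : 0 ≤ c.q)
    {F : ℕ → MeasurableSpace Ω} {ζ : ℕ → Ω → Z} (hs : IsFreshStream Pr P.lawZ F ζ)
    {L : Ω → P.Lam} (hL : Measurable[F 0] L) (t : ℕ) :
    Measurable[F t] (fun ω => llSolver P η (L ω) (fun i => ζ i ω) t) ∧
    ∫⁻ ω, ENNReal.ofReal (‖llSolver P η (L ω) (fun i => ζ i ω) t - P.lower (L ω)‖ ^ 2) ∂Pr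
      ≤ ENNReal.ofReal (c.dw β γ / (γ + t)) := by
  have := horacle.probZ
  have hq1 := hreg.q_lt_one
  have hβ' := c.one_lt_mul hq0 hq1 hβ
  have hγ1 := c.one_lt_gamma hc hq0 hq1 hβ hγ
  have hβ0 : 0 ≤ β := by linarith [c.one_lt_beta hq0 hq1 hβ]
  have h := hs.lintegral_norm_iterate_sub_sq_le hL (W := fun _ => 1) measurable_const
    (That := fun w l z => P.Phihat w l z) horacle.measurable_Phihat
    (T := fun w l => P.Phi w l) (xs := fun l => P.lower l) hreg.continuous_lower.measurable
    (s₁ := fun _ => c.sig1) (s₂ := c.sig2) hq0 hq1 hc.sig2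
    (fun w l => horacle.memLp_Phihat w l l.2) (fun w l => horacle.mean_Phihat w l l.2)
    (fun w l => horacle.var_Phihat w l l.2)
    (fun w l => by
      have := hreg.norm_Phi_sub_le l.2 w (P.lower l)
      rwa [hreg.Phi_lower l.2] at this)
    (x := fun i ω => llSolver P η (L ω) (fun i => ζ i ω) i) hη (fun _ => rfl) (fun _ _ => rfl)
    hβ' (le_trans (by gcongr; exact le_max_right _ _) hγ) (D := c.dw β γ) (s := c.sig1)
    (c.dw_nonneg (by linarith)) hc.sig1
    (by
      calc ∫⁻ ω, 1 * ENNReal.ofReal (‖P.lower (L ω)‖ ^ 2) ∂Pr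
          ≤ ∫⁻ _, ENNReal.ofReal (c.dw β γ / γ) ∂Pr := by
            refine lintegral_mono fun ω => ?_
            rw [one_mul]
            refine ENNReal.ofReal_le_ofReal ?_
            rw [le_div_iff₀ (by linarith), mul_comm]
            refine le_trans ?_ (le_max_left _ _)
            have := hup.bound_lower _ (L ω).2
            gcongr
        _ = _ := by simp)
    (by simp)
    (by
      have h1 : β ^ 2 * c.sig1 / (β * (1 - c.q ^ 2) - 1) ≤ c.dw β γ := le_max_right _ _
      rw [div_le_iff₀ (by linarith)] at h1
      linarith) t
  simpa using h

/-- Weighted mean square error of the mini-batch gradient with respect to the lower-level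
variable; the weight may depend on the point at which the gradient is estimated. -/
theorem lintegral_batchGrad1_sub_sq_le (hreg : P.Regular c) (hc : c.Nonneg)
    (hup : P.UpperRegular c) (horacle : P.Oracle c)
    {F : ℕ → MeasurableSpace Ω} {ξ : ℕ → Ω → Ξ} (hs : IsFreshStream Pr P.lawX F ξ)
    {Y : Ω → Vec d × P.Lam} (hY : Measurable[F 0] Y) {W : Vec d × P.Lam → ℝ≥0∞}
    (hW : Measurable W) {M : ℝ} (hM : ∫⁻ ω, W (Y ω) ∂Pr ≤ ENNReal.ofReal M) {J : ℕ}
    (hJ : 1 ≤ J) :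
    Measurable[F J] (fun ω => batchGrad1 P J (fun j => ξ j ω) (Y ω).1 (Y ω).2) ∧
    ∫⁻ ω, W (Y ω) * ENNReal.ofReal (‖batchGrad1 P J (fun j => ξ j ω) (Y ω).1 (Y ω).2
      - grad1 P.E (Y ω).1 (Y ω).2‖ ^ 2) ∂Pr ≤ ENNReal.ofReal (c.sigE1 * M / J) := by
  have := horacle.probX
  have hmE : Measurable fun p : Vec d × P.Lam => grad1 P.E p.1 p.2 :=
    (Problem.continuous_of_lipschitz_each hreg.lip_grad1 hup.lip_grad1).measurable
  exact hs.lintegral_norm_average_sub_sq_le hY hW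
    (h := fun a x => grad1 (fun w l => P.Ehat w l x) a.1 a.2) horacle.measurable_grad1 hmE
    (σ := fun _ => c.sigE1) (fun a => horacle.memLp_grad1 a.1 a.2 a.2.2)
    (fun a => horacle.mean_grad1 a.1 a.2 a.2.2) (fun a => horacle.var_grad1 a.1 a.2 a.2.2)
    (lintegral_le_of_le_mul hc.sigE1 (fun ω => (mul_comm _ _).le) hM) hJ

/-- Mean square error of the mini-batch gradient with respect to the upper-level variable. -/
theorem lintegral_batchGrad2_sub_sq_le (hreg : P.Regular c) (hup : P.UpperRegular c)
    (horacle : P.Oracle c)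
    {F : ℕ → MeasurableSpace Ω} {ξ : ℕ → Ω → Ξ} (hs : IsFreshStream Pr P.lawX F ξ)
    {Y : Ω → Vec d × P.Lam} (hY : Measurable[F 0] Y) {J : ℕ} (hJ : 1 ≤ J) :
    Measurable[F J] (fun ω => batchGrad2 P J (fun j => ξ j ω) (Y ω).1 (Y ω).2) ∧
    ∫⁻ ω, ENNReal.ofReal (‖batchGrad2 P J (fun j => ξ j ω) (Y ω).1 (Y ω).2
      - grad2 P.E (Y ω).1 (Y ω).2‖ ^ 2) ∂Pr ≤ ENNReal.ofReal (c.sigE2 / J) := by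
  have := horacle.probX
  have hmE : Measurable fun p : Vec d × P.Lam => grad2 P.E p.1 p.2 :=
    (Problem.continuous_of_lipschitz_each hreg.lip_grad2 hup.lip_grad2).measurable
  have h := hs.lintegral_norm_average_sub_sq_le hY (W := fun _ => 1) measurable_const
    (h := fun a x => grad2 (fun w l => P.Ehat w l x) a.1 a.2) horacle.measurable_grad2 hmE
    (σ := fun _ => c.sigE2) (fun a => horacle.memLp_grad2 a.1 a.2 a.2.2)
    (fun a => horacle.mean_grad2 a.1 a.2 a.2.2) (fun a => horacle.var_grad2 a.1 a.2 a.2.2)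
    (K := c.sigE2) (by simp) hJ
  simp only [one_mul] at h
  exact h

/-- Weighted second moment of a mini-batch gradient. -/
theorem lintegral_batchGrad1_sq_le (hreg : P.Regular c) (hc : c.Nonneg)
    (hup : P.UpperRegular c) (horacle : P.Oracle c)
    {F : ℕ → MeasurableSpace Ω} {ξ : ℕ → Ω → Ξ} (hs : IsFreshStream Pr P.lawX F ξ)
    {Y : Ω → Vec d × P.Lam} (hY : Measurable[F 0] Y) {W : Vec d × P.Lam → ℝ≥0∞}
    (hW : Measurable W) {M : ℝ} (hM0 : 0 ≤ M) (hM : ∫⁻ ω, W (Y ω) ∂Pr ≤ ENNReal.ofReal M)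
    {J : ℕ} (hJ : 1 ≤ J) :
    ∫⁻ ω, W (Y ω) * ENNReal.ofReal (‖batchGrad1 P J (fun j => ξ j ω) (Y ω).1 (Y ω).2‖ ^ 2) ∂Pr
      ≤ ENNReal.ofReal (2 * (c.LE ^ 2 + c.sigE1) * M) := by
  have hJ0 : (1 : ℝ) ≤ J := by exact_mod_cast hJ
  have hE := hc.sigE1
  refine (lintegral_le_of_le_mul_add (k := 2 * c.LE ^ 2) (by positivity) hM0 (by positivity)
    (hW.comp (hY.mono (hs.le 0) le_rfl)) (fun ω => ?_) hM
    (lintegral_le_of_le_mul (k := 2) (by norm_num) (fun ω => le_rfl)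
      (lintegral_batchGrad1_sub_sq_le hreg hc hup horacle hs hY hW hM hJ).2)).trans ?_
  · have h1 := norm_add_sq_le_two_mul (grad1 P.E (Y ω).1 (Y ω).2)
      (batchGrad1 P J (fun j => ξ j ω) (Y ω).1 (Y ω).2 - grad1 P.E (Y ω).1 (Y ω).2)
    rw [add_sub_cancel] at h1
    have h2 := pow_le_pow_left₀ (norm_nonneg _)
      (hreg.norm_grad1_le hc (Y ω).2.2 (Y ω).1) 2
    rw [Function.comp_apply, mul_comm (ENNReal.ofReal (2 * c.LE ^ 2)), mul_left_comm, ← mul_add,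
      ← ENNReal.ofReal_mul (by norm_num), ← ENNReal.ofReal_add (by positivity) (by positivity)]
    gcongr
    linarith
  · refine ENNReal.ofReal_le_ofReal ?_
    have : c.sigE1 * M / J ≤ c.sigE1 * M := div_le_self (by positivity) hJ0
    linarith

/-- Weighted mean square error of the linear-system solver with a random right-hand side `g` that
is known before its samples are drawn. The error is measured from the exact solution for the same
right-hand side. The factor `2` in the bound `hK` on the weighted second moment of `g` is the price
of splitting a mini-batch gradient into its mean and its error without using their orthogonality. -/
theorem lintegral_lsSolver_sub_sq_le (hc : c.Nonneg) (hreg : P.Regular c)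
    (hup : P.UpperRegular c) (horacle : P.Oracle c) (hβ : 1 / (1 - c.q ^ 2) < β)
    (hγ : β * (1 + c.sigTilde2) ≤ γ) (hη : ∀ j, η j = β / (γ + j)) (hq0 : 0 ≤ c.q)
    {F : ℕ → MeasurableSpace Ω} {ζ : ℕ → Ω → Z} (hs : IsFreshStream Pr P.lawZ F ζ)
    {Y : Ω → Vec d × P.Lam} (hY : Measurable[F 0] Y) {g : Ω → Vec d} (hg : Measurable[F 0] g)
    {W : Vec d × P.Lam → ℝ≥0∞} (hW : Measurable W) {M : ℝ} (hM0 : 0 ≤ M)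
    (hK : ∫⁻ ω, W (Y ω) * ENNReal.ofReal (‖g ω‖ ^ 2) ∂Pr
      ≤ ENNReal.ofReal (2 * (c.LE ^ 2 + c.sigE1) * M)) (k : ℕ) :
    Measurable[F k] (fun ω => lsSolver P η (Y ω).1 (Y ω).2 (g ω) (fun i => ζ i ω) k) ∧
    ∫⁻ ω, W (Y ω) * ENNReal.ofReal (‖lsSolver P η (Y ω).1 (Y ω).2 (g ω) (fun i => ζ i ω) k
      - Ring.inverse (1 - ContinuousLinearMap.adjoint (D1 P.Phi (Y ω).1 (Y ω).2)) (g ω)‖ ^ 2) ∂Pr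
      ≤ ENNReal.ofReal (2 * M * c.dv β γ / (γ + k)) := by
  have := horacle.probZ
  have hq1 := hreg.q_lt_one
  have hq : 0 < 1 - c.q := by linarith
  have hβ' := c.one_lt_mul hq0 hq1 hβ
  have hγ1 := c.one_lt_gamma hc hq0 hq1 hβ hγ
  have hβ0 : 0 ≤ β := by linarith [c.one_lt_beta hq0 hq1 hβ]
  have hE := hc.sigE1
  have hS := hc.sig1'
  have hdv := c.dv_nonneg (β := β) hc (γ := γ) (by linarith)
  have hWm := (hW.comp measurable_fst : Measurable fun a : (Vec d × P.Lam) × Vec d => W a.1)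
  refine hs.lintegral_norm_iterate_sub_sq_le (Y := fun ω => (Y ω, g ω)) (hY.prodMk hg) hWm
    (That := fun v a z =>
      ContinuousLinearMap.adjoint (D1 (fun w l => P.Phihat w l z) a.1.1 a.1.2) v + a.2)
    ?_ (T := fun v a => ContinuousLinearMap.adjoint (D1 P.Phi a.1.1 a.1.2) v + a.2)
    (xs := fun a => Ring.inverse (1 - ContinuousLinearMap.adjoint (D1 P.Phi a.1.1 a.1.2)) a.2)
    (hreg.continuous_inverse_apply hup).measurable
    (s₁ := fun a => 2 * c.sig1' / (1 - c.q) ^ 2 * ‖a.2‖ ^ 2)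
    (s₂ := 2 * c.sig1' / (1 - c.q) ^ 2) hq0 hq1 (by positivity)
    (fun v a => memLp_adjoint_add (horacle.memLp_D1 a.1.1 a.1.2 a.1.2.2) v a.2)
    (fun v a => by
      rw [integral_adjoint_add (horacle.memLp_D1 a.1.1 a.1.2 a.1.2.2),
        horacle.mean_D1 _ _ a.1.2.2])
    (fun v a => ?_) (fun v a => ?_)
    (x := fun i ω => lsSolver P η (Y ω).1 (Y ω).2 (g ω) (fun i => ζ i ω) i) hη (fun _ => rfl)
    (fun _ _ => rfl) hβ' (le_trans (by gcongr; exact le_max_left _ _) hγ)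
    (D := 2 * M * c.dv β γ)
    (s := 2 * c.sig1' / (1 - c.q) ^ 2 * (2 * (c.LE ^ 2 + c.sigE1) * M))
    (by positivity) (by positivity) ?_ ?_ ?_ k
  · have h1 : Measurable fun p : (Vec d × ((Vec d × P.Lam) × Vec d)) × Z =>
        ((p.1.2.1, p.1.1), p.2) := by fun_prop
    have h2 : Measurable fun p : (Vec d × ((Vec d × P.Lam) × Vec d)) × Z => p.1.2.2 := by
      fun_prop
    exact (horacle.measurable_adjoint_D1.comp h1).add h2
  · -- `‖v‖ ≤ ‖v̄‖ + ‖v - v̄‖`, and both are controlled by `g` and by the residual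
    refine (vecVar_adjoint_add_le (horacle.memLp_D1 a.1.1 a.1.2 a.1.2.2) v a.2).trans ?_
    have h1 := horacle.var_D1 a.1.1 a.1.2 a.1.2.2
    have h2 := one_sub_norm_le_of_contraction (hreg.norm_adjoint_D1_le a.1.2.2 a.1.1) v
    set A := ContinuousLinearMap.adjoint (D1 P.Phi a.1.1 a.1.2)
    have e : v - A v = a.2 + -(A v + a.2 - v) := by abel
    have h3 := norm_add_sq_le_two_mul a.2 (-(A v + a.2 - v))
    rw [← e, norm_neg] at h3
    have h4 : (1 - c.q) ^ 2 * ‖v‖ ^ 2 ≤ 2 * ‖a.2‖ ^ 2 + 2 * ‖A v + a.2 - v‖ ^ 2 := by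
      rw [← mul_pow]
      exact (pow_le_pow_left₀ (by positivity) h2 2).trans h3
    have h5 : ‖v‖ ^ 2 ≤ (2 * ‖a.2‖ ^ 2 + 2 * ‖A v + a.2 - v‖ ^ 2) / (1 - c.q) ^ 2 := by
      rwa [le_div_iff₀ (by positivity), mul_comm]
    calc ‖v‖ ^ 2 * vecVar P.lawZ (fun z => D1 (fun w l => P.Phihat w l z) a.1.1 a.1.2)
        ≤ ‖v‖ ^ 2 * c.sig1' := by gcongr
      _ ≤ (2 * ‖a.2‖ ^ 2 + 2 * ‖A v + a.2 - v‖ ^ 2) / (1 - c.q) ^ 2 * c.sig1' := by gcongr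
      _ = _ := by ring
  · have h1 := one_sub_apply_inverse (hreg.norm_adjoint_D1_le a.1.2.2 a.1.1) hq1 a.2
    set A := ContinuousLinearMap.adjoint (D1 P.Phi a.1.1 a.1.2)
    set r := Ring.inverse (1 - A) a.2
    have e : A v + a.2 - r = A (v - r) := by rw [← h1, map_sub]; abel
    change ‖A v + a.2 - r‖ ≤ c.q * ‖v - r‖
    rw [e]
    refine (A.le_opNorm _).trans ?_
    gcongr
    exact hreg.norm_adjoint_D1_le a.1.2.2 a.1.1
  · refine (lintegral_le_of_le_mul (k := 1 / (1 - c.q) ^ 2) (by positivity) (fun ω => ?_)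
      hK).trans (ENNReal.ofReal_le_ofReal ?_)
    · change W (Y ω) * _ ≤ _
      rw [mul_left_comm, ← ENNReal.ofReal_mul (by positivity)]
      gcongr
      rw [one_div_mul_eq_div, ← div_pow]
      exact pow_le_pow_left₀ (norm_nonneg _) (norm_inverse_one_sub_apply_le
        (hreg.norm_adjoint_D1_le (Y ω).2.2 (Y ω).1) hq1 (g ω)) 2
    · have h1 : (c.LE ^ 2 + c.sigE1) / (1 - c.q) ^ 2 * γ ≤ c.dv β γ := le_max_left _ _
      rw [le_div_iff₀ (by linarith)]
      calc _ = 2 * M * ((c.LE ^ 2 + c.sigE1) / (1 - c.q) ^ 2 * γ) := by ring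
        _ ≤ _ := by gcongr
  · refine lintegral_le_of_le_mul (by positivity) (fun ω => ?_) hK
    change W (Y ω) * _ ≤ _
    rw [mul_left_comm, ← ENNReal.ofReal_mul (by positivity)]
  · have h1 : 2 * (c.LE ^ 2 + c.sigE1) * c.sig1' / (1 - c.q) ^ 2
        * (β ^ 2 / (β * (1 - c.q ^ 2) - 1)) ≤ c.dv β γ := le_max_right _ _
    rw [← mul_div_assoc, div_le_iff₀ (by linarith)] at h1
    have h2 := mul_le_mul_of_nonneg_left h1 (show 0 ≤ 2 * M by positivity)
    calc _ = 2 * M * (2 * (c.LE ^ 2 + c.sigE1) * c.sig1' / (1 - c.q) ^ 2 * β ^ 2) := by ring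
      _ ≤ _ := h2
      _ = _ := by ring

/-- Mean square error of the mini-batch transposed Jacobian applied to a random vector `v` that is
known before the samples are drawn. Only the product with `v` is averaged, because mini-batching
need not reduce a variance measured in the spectral norm. -/
theorem lintegral_batchD2_sub_sq_le (hreg : P.Regular c) (hc : c.Nonneg)
    (hup : P.UpperRegular c) (horacle : P.Oracle c)
    {F : ℕ → MeasurableSpace Ω} {ζ : ℕ → Ω → Z} (hs : IsFreshStream Pr P.lawZ F ζ)
    {Y : Ω → Vec d × P.Lam} (hY : Measurable[F 0] Y) {v : Ω → Vec d} (hv : Measurable[F 0] v)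
    {K : ℝ} (hK : ∫⁻ ω, ENNReal.ofReal (‖v ω‖ ^ 2) ∂Pr ≤ ENNReal.ofReal K) {J : ℕ}
    (hJ : 1 ≤ J) :
    Measurable[F J] (fun ω => ContinuousLinearMap.adjoint
      (batchD2 P J (fun j => ζ j ω) (Y ω).1 (Y ω).2) (v ω)) ∧
    ∫⁻ ω, ENNReal.ofReal (‖ContinuousLinearMap.adjoint
        (batchD2 P J (fun j => ζ j ω) (Y ω).1 (Y ω).2) (v ω)
      - ContinuousLinearMap.adjoint (D2 P.Phi (Y ω).1 (Y ω).2) (v ω)‖ ^ 2) ∂Pr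
      ≤ ENNReal.ofReal (c.sig2' * K / J) := by
  have := horacle.probZ
  have hcD := Problem.continuous_of_lipschitz_each hreg.lip_D2 hup.lip_D2
  have hmD : Measurable fun p : (Vec d × P.Lam) × Vec d =>
      ContinuousLinearMap.adjoint (D2 P.Phi p.1.1 p.1.2) p.2 := by
    have h1 : Continuous fun p : Vec d × P.Lam =>
        ContinuousLinearMap.adjoint (D2 P.Phi p.1 p.2) :=
      ContinuousLinearMap.adjoint.continuous.comp hcD
    exact ((h1.comp continuous_fst).clm_apply continuous_snd).measurable
  have hYv : Measurable[F 0] fun ω => (Y ω, v ω) := hY.prodMk hv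
  have hD := fun a : (Vec d × P.Lam) × Vec d => horacle.memLp_D2 a.1.1 a.1.2 a.1.2.2
  have hLp := fun a : (Vec d × P.Lam) × Vec d => by
    have := memLp_adjoint_add (hD a) a.2 0
    simpa only [add_zero] using this
  have hmean := fun a : (Vec d × P.Lam) × Vec d => by
    have := integral_adjoint_add (hD a) a.2 0
    simpa only [add_zero, horacle.mean_D2 _ _ a.1.2.2] using this
  have h := hs.lintegral_norm_average_sub_sq_le hYv (W := fun _ => 1) measurable_const
    (h := fun a z => ContinuousLinearMap.adjoint (D2 (fun w l => P.Phihat w l z) a.1.1 a.1.2) a.2)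
    horacle.measurable_adjoint_D2 hmD (σ := fun a => c.sig2' * ‖a.2‖ ^ 2) hLp hmean
    (fun a => by
      have h3 := vecVar_adjoint_add_le (hD a) a.2 0
      simp only [add_zero] at h3
      refine h3.trans ?_
      rw [mul_comm]
      gcongr
      exact horacle.var_D2 a.1.1 a.1.2 a.1.2.2)
    (lintegral_le_of_le_mul hc.sig2' (fun ω => by rw [one_mul, ENNReal.ofReal_mul hc.sig2']) hK)
    hJ
  have e : ∀ ω, ContinuousLinearMap.adjoint
        (batchD2 P J (fun j => ζ j ω) (Y ω).1 (Y ω).2) (v ω)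
      = (J : ℝ)⁻¹ • ∑ j ∈ Finset.range J, ContinuousLinearMap.adjoint
          (D2 (fun w l => P.Phihat w l (ζ j ω)) (Y ω).1 (Y ω).2) (v ω) := fun ω => by
    rw [← adjointApply_apply, batchD2, map_smul, map_sum]
    rfl
  simp only [e]
  simpa only [one_mul] using h

theorem norm_add_five_sq_le {V : Type*} [SeminormedAddCommGroup V] (x₁ x₂ x₃ x₄ x₅ : V) :
    ‖x₁ + x₂ + x₃ + x₄ + x₅‖ ^ 2
      ≤ 5 * ‖x₁‖ ^ 2 + (5 * ‖x₂‖ ^ 2 + (5 * ‖x₃‖ ^ 2 + (5 * ‖x₄‖ ^ 2 + 5 * ‖x₅‖ ^ 2))) := by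
  have h1 : ‖x₁ + x₂ + x₃ + x₄ + x₅‖ ≤ ‖x₁‖ + ‖x₂‖ + ‖x₃‖ + ‖x₄‖ + ‖x₅‖ :=
    (norm_add_le _ _).trans (add_le_add_left (norm_add₄_le) _)
  have h2 := pow_le_pow_left₀ (norm_nonneg _) h1 2
  refine h2.trans ?_
  nlinarith [sq_nonneg (‖x₁‖ - ‖x₂‖), sq_nonneg (‖x₁‖ - ‖x₃‖), sq_nonneg (‖x₁‖ - ‖x₄‖),
    sq_nonneg (‖x₁‖ - ‖x₅‖), sq_nonneg (‖x₂‖ - ‖x₃‖), sq_nonneg (‖x₂‖ - ‖x₄‖),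
    sq_nonneg (‖x₂‖ - ‖x₅‖), sq_nonneg (‖x₃‖ - ‖x₄‖), sq_nonneg (‖x₃‖ - ‖x₅‖),
    sq_nonneg (‖x₄‖ - ‖x₅‖)]

/-- Pointwise error decomposition of the stochastic hypergradient into the mini-batch errors of
`∇₂E` and `∂₂Phi`, the error of the linear-system solver, the mini-batch error of `∇₁E`, and the
error of the lower-level solver. Here `g₁`, `g₂` are estimates of `∇₁E(w,l)`, `∇₂E(w,l)`, `v` of
the solution of the linear system with right-hand side `g₁`, and `u` of `∂₂Phi(w,l)ᵀ v`. -/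
theorem Problem.Regular.norm_add_sub_hypergrad_sq_le (hreg : P.Regular c) (hc : c.Nonneg)
    (hup : P.UpperRegular c) {l : Vec m} (hl : l ∈ P.Lam) (w v g₁ : Vec d) (g₂ u : Vec m) :
    ‖g₂ + u - P.hypergrad l‖ ^ 2 ≤ 5 * ‖g₂ - grad2 P.E w l‖ ^ 2
      + (5 * ‖u - ContinuousLinearMap.adjoint (D2 P.Phi w l) v‖ ^ 2
      + (5 * ((2 * c.LPhi ^ 2 + 2 * c.nu2 ^ 2 * ‖w - P.lower l‖ ^ 2)
          * ‖v - Ring.inverse (1 - ContinuousLinearMap.adjoint (D1 P.Phi w l)) g₁‖ ^ 2)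
      + (5 / (1 - c.q) ^ 2 * ((2 * c.LPhi ^ 2 + 2 * c.nu2 ^ 2 * ‖w - P.lower l‖ ^ 2)
          * ‖g₁ - grad1 P.E w l‖ ^ 2)
      + 5 * c.c1 ^ 2 * ‖w - P.lower l‖ ^ 2))) := by
  have hq : 0 < 1 - c.q := by linarith [hreg.q_lt_one]
  set A := ContinuousLinearMap.adjoint (D1 P.Phi w l)
  set B := ContinuousLinearMap.adjoint (D2 P.Phi w l) with hB
  have e : g₂ + u - P.hypergrad l = (g₂ - grad2 P.E w l) + (u - B v)
      + B (v - Ring.inverse (1 - A) g₁) + B (Ring.inverse (1 - A) (g₁ - grad1 P.E w l))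
      + (P.hypergradAt w l - P.hypergrad l) := by
    have e1 : P.hypergradAt w l = grad2 P.E w l + B (Ring.inverse (1 - A) (grad1 P.E w l)) := rfl
    rw [e1, map_sub B, map_sub, map_sub B]
    abel
  have hBn : ‖B‖ ^ 2 ≤ 2 * c.LPhi ^ 2 + 2 * c.nu2 ^ 2 * ‖w - P.lower l‖ ^ 2 := by
    have h1 := norm_add_sq_le_two_mul (D2 P.Phi (P.lower l) l)
      (D2 P.Phi w l - D2 P.Phi (P.lower l) l)
    rw [add_sub_cancel] at h1
    have h2 := pow_le_pow_left₀ (norm_nonneg _) (hup.bound_D2 l hl) 2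
    have h3 := pow_le_pow_left₀ (norm_nonneg _) (hreg.lip_D2 l hl w (P.lower l)) 2
    rw [mul_pow] at h3
    rw [hB, LinearIsometryEquiv.norm_map]
    linarith
  have h1 : ‖B (v - Ring.inverse (1 - A) g₁)‖ ^ 2
      ≤ (2 * c.LPhi ^ 2 + 2 * c.nu2 ^ 2 * ‖w - P.lower l‖ ^ 2)
        * ‖v - Ring.inverse (1 - A) g₁‖ ^ 2 := by
    refine (pow_le_pow_left₀ (norm_nonneg _) (B.le_opNorm _) 2).trans ?_
    rw [mul_pow]
    gcongr
  have h2 : ‖B (Ring.inverse (1 - A) (g₁ - grad1 P.E w l))‖ ^ 2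
      ≤ (2 * c.LPhi ^ 2 + 2 * c.nu2 ^ 2 * ‖w - P.lower l‖ ^ 2)
        * (‖g₁ - grad1 P.E w l‖ / (1 - c.q)) ^ 2 := by
    refine (pow_le_pow_left₀ (norm_nonneg _) (B.le_opNorm _) 2).trans ?_
    rw [mul_pow]
    gcongr
    exact norm_inverse_one_sub_apply_le (hreg.norm_adjoint_D1_le hl w) hreg.q_lt_one _
  have h3 := pow_le_pow_left₀ (norm_nonneg _)
    (hreg.norm_hypergradAt_sub_hypergrad_le hc hup hl w) 2
  rw [mul_pow] at h3
  have e2 : 5 / (1 - c.q) ^ 2 * ((2 * c.LPhi ^ 2 + 2 * c.nu2 ^ 2 * ‖w - P.lower l‖ ^ 2)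
      * ‖g₁ - grad1 P.E w l‖ ^ 2)
      = 5 * ((2 * c.LPhi ^ 2 + 2 * c.nu2 ^ 2 * ‖w - P.lower l‖ ^ 2)
        * (‖g₁ - grad1 P.E w l‖ / (1 - c.q)) ^ 2) := by
    rw [div_pow]; ring
  rw [e, e2]
  refine (norm_add_five_sq_le _ _ _ _ _).trans ?_
  linarith

/-- The five contributions to the mean square error of the stochastic hypergradient add up to at
most `10 (c_b + c_v) / J`. -/
theorem Constants.mean_square_error_le (hc : c.Nonneg) (hq1 : c.q < 1) (hγ : 1 ≤ γ) {J : ℝ}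
    (hJ : 1 ≤ J) :
    5 * (c.sigE2 / J)
      + (5 * (c.sig2' * (4 * (c.dv β γ + (c.LE ^ 2 + c.sigE1) / (1 - c.q) ^ 2)) / J)
      + (5 * (2 * (2 * c.LPhi ^ 2 + 2 * c.nu2 ^ 2 * c.dw β γ) * c.dv β γ / (γ + J))
      + (5 / (1 - c.q) ^ 2
        * (c.sigE1 * (2 * c.LPhi ^ 2 + 2 * c.nu2 ^ 2 * c.dw β γ) / J)
      + 5 * c.c1 ^ 2 * (c.dw β γ / (γ + J))))) ≤ 10 * (c.cb β γ + c.cv β γ) / J := by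
  have hq : 0 < 1 - c.q := by linarith
  have hdw := c.dw_nonneg (β := β) (γ := γ) (by linarith)
  have hdv := c.dv_nonneg (β := β) (γ := γ) hc (by linarith)
  have h1 := hc.sigE1
  have h2 := hc.sigE2
  have h3 := hc.sig2'
  have hmono : ∀ x : ℝ, 0 ≤ x → x / (γ + J) ≤ x / J := fun x hx => by gcongr; linarith
  have h4 := hmono (2 * (2 * c.LPhi ^ 2 + 2 * c.nu2 ^ 2 * c.dw β γ) * c.dv β γ) (by positivity)
  have h5 := hmono (c.dw β γ) hdw
  have h6 := mul_le_mul_of_nonneg_left h5 (show 0 ≤ 5 * c.c1 ^ 2 by positivity)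
  have h7 : 0 ≤ (5 * c.sigE2 + 60 * (c.sig2' * c.dv β γ)
      + 60 * (c.sig2' * (c.LE ^ 2 + c.sigE1) / (1 - c.q) ^ 2)
      + 120 * (c.LPhi ^ 2 * c.dv β γ) + 120 * (c.nu2 ^ 2 * c.dw β γ * c.dv β γ)
      + 70 * (c.LPhi ^ 2 * c.sigE1 / (1 - c.q) ^ 2)
      + 70 * (c.nu2 ^ 2 * c.dw β γ * c.sigE1 / (1 - c.q) ^ 2)
      + 55 * (c.c1 ^ 2 * c.dw β γ)) / J := by positivity
  refine le_trans (add_le_add_right (add_le_add_right (add_le_add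
    (mul_le_mul_of_nonneg_left h4 (by norm_num)) (add_le_add_right h6 _)) _) _) ?_
  rw [← sub_nonneg]
  refine h7.trans (le_of_eq ?_)
  rw [Constants.cb, Constants.cv]
  field_simp
  ring

set_option maxHeartbeats 400000 in
/-- Mean square error of stochastic implicit differentiation at a random feasible point `L` that is
independent of its samples; the four sample streams are drawn one after the other. -/
theorem lintegral_sid_sub_hypergrad_sq_le (hc : c.Nonneg) (hreg : P.Regular c)
    (hup : P.UpperRegular c) (horacle : P.Oracle c) (hβ : 1 / (1 - c.q ^ 2) < β)
    (hγ : β * (1 + c.sigTilde2) ≤ γ) (hη : ∀ j, η j = β / (γ + j)) (hq0 : 0 ≤ c.q)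
    {F₁ F₂ F₃ F₄ : ℕ → MeasurableSpace Ω} {zLL zLS zJac : ℕ → Ω → Z} {x : ℕ → Ω → Ξ}
    (hs₁ : IsFreshStream Pr P.lawZ F₁ zLL) (hs₂ : IsFreshStream Pr P.lawX F₂ x)
    (hs₃ : IsFreshStream Pr P.lawZ F₃ zLS) (hs₄ : IsFreshStream Pr P.lawZ F₄ zJac)
    (h₁₂ : ∀ i, F₁ i ≤ F₂ 0) (h₂₃ : ∀ i, F₂ i ≤ F₃ 0) (h₃₄ : ∀ i, F₃ i ≤ F₄ 0)
    {L : Ω → P.Lam} (hL : Measurable[F₁ 0] L) {J : ℕ} (hJ : 1 ≤ J) :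
    Measurable[F₄ J] (fun ω => sid P η J J J (L ω) (fun i => zLL i ω) (fun j => x j ω)
      (fun i => zLS i ω) (fun j => zJac j ω)) ∧
    ∫⁻ ω, ENNReal.ofReal (‖sid P η J J J (L ω) (fun i => zLL i ω) (fun j => x j ω)
      (fun i => zLS i ω) (fun j => zJac j ω) - P.hypergrad (L ω)‖ ^ 2) ∂Pr
      ≤ ENNReal.ofReal (10 * (c.cb β γ + c.cv β γ) / J) := by
  have hq1 := hreg.q_lt_one
  have hq : 0 < 1 - c.q := by linarith
  have hγ1 := c.one_lt_gamma hc hq0 hq1 hβ hγ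
  have hdw := c.dw_nonneg (β := β) (γ := γ) (by linarith)
  have hdv := c.dv_nonneg (β := β) (γ := γ) hc (by linarith)
  have hE := hc.sigE1
  have hE2 := hc.sigE2
  have hS2 := hc.sig2'
  have hJ0 : (1 : ℝ) ≤ J := by exact_mod_cast hJ
  -- the lower-level solver
  obtain ⟨hw, hwE⟩ := lintegral_llSolver_sub_sq_le hc hreg hup horacle hβ hγ hη hq0 hs₁ hL J
  set w := fun ω => llSolver P η (L ω) (fun i => zLL i ω) J with hwdef
  have hY : Measurable[F₂ 0] fun ω => (w ω, L ω) :=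
    (hw.mono (h₁₂ J) le_rfl).prodMk (hL.mono (h₁₂ 0) le_rfl)
  -- the weight bounds `‖∂₂Phi(w,l)‖²`
  set W : Vec d × P.Lam → ℝ≥0∞ := fun p =>
    ENNReal.ofReal (2 * c.LPhi ^ 2 + 2 * c.nu2 ^ 2 * ‖p.1 - P.lower p.2‖ ^ 2) with hWdef
  have hlow : Measurable fun p : Vec d × P.Lam => P.lower p.2 :=
    hreg.continuous_lower.measurable.comp measurable_snd
  have hW : Measurable W := by fun_prop
  set M := 2 * c.LPhi ^ 2 + 2 * c.nu2 ^ 2 * c.dw β γ with hMdef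
  have hM0 : 0 ≤ M := by positivity
  have hdwJ : c.dw β γ / (γ + J) ≤ c.dw β γ := div_le_self hdw (by linarith)
  have hM : ∫⁻ ω, W (w ω, L ω) ∂Pr ≤ ENNReal.ofReal M := by
    refine (lintegral_le_of_le_mul_add (k := 2 * c.LPhi ^ 2) (g₁ := fun _ => 1) (b₁ := 1)
      (by positivity) zero_le_one (by positivity) measurable_const (fun ω => ?_) (by simp)
      (lintegral_le_of_le_mul (k := 2 * c.nu2 ^ 2) (by positivity) (fun ω => le_rfl)
        hwE)).trans (ENNReal.ofReal_le_ofReal ?_)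
    · rw [mul_one, ← ENNReal.ofReal_mul (by positivity)]
      exact ENNReal.ofReal_add_le
    · have := mul_le_mul_of_nonneg_left hdwJ (show 0 ≤ 2 * c.nu2 ^ 2 by positivity)
      linarith
  have hM1 : ∫⁻ ω, (fun _ => 1 : Vec d × P.Lam → ℝ≥0∞) (w ω, L ω) ∂Pr ≤ ENNReal.ofReal 1 := by
    simp
  -- the mini-batch gradients
  obtain ⟨hg, hgE⟩ := lintegral_batchGrad1_sub_sq_le hreg hc hup horacle hs₂ hY hW hM hJ
  have hgK := lintegral_batchGrad1_sq_le hreg hc hup horacle hs₂ hY hW hM0 hM hJ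
  have hgK1 := lintegral_batchGrad1_sq_le hreg hc hup horacle hs₂ hY measurable_const
    zero_le_one hM1 hJ
  obtain ⟨hg2, hg2E⟩ := lintegral_batchGrad2_sub_sq_le hreg hup horacle hs₂ hY hJ
  set g := fun ω => batchGrad1 P J (fun j => x j ω) (w ω) (L ω) with hgdef
  set g2 := fun ω => batchGrad2 P J (fun j => x j ω) (w ω) (L ω) with hg2def
  -- the linear-system solver
  have hY3 : Measurable[F₃ 0] fun ω => (w ω, L ω) := hY.mono (h₂₃ 0) le_rfl
  have hg3 : Measurable[F₃ 0] g := hg.mono (h₂₃ J) le_rfl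
  obtain ⟨hv, hvE⟩ := lintegral_lsSolver_sub_sq_le hc hreg hup horacle hβ hγ hη hq0 hs₃ hY3 hg3
    hW hM0 hgK J
  obtain ⟨-, hvE1⟩ := lintegral_lsSolver_sub_sq_le hc hreg hup horacle hβ hγ hη hq0 hs₃ hY3 hg3
    measurable_const zero_le_one hgK1 J
  set v := fun ω => lsSolver P η (w ω) (L ω) (g ω) (fun i => zLS i ω) J with hvdef
  set vbar := fun ω => Ring.inverse (1 - ContinuousLinearMap.adjoint (D1 P.Phi (w ω) (L ω))) (g ω)
    with hvbardef
  simp only [one_mul, mul_one] at hgK1 hvE1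
  have hY4 : Measurable[F₄ 0] fun ω => (w ω, L ω) := hY3.mono (h₃₄ 0) le_rfl
  have hv4 : Measurable[F₄ 0] v := hv.mono (h₃₄ J) le_rfl
  have hYg : Measurable[F₄ 0] fun ω => ((w ω, L ω), g ω) :=
    hY4.prodMk (hg3.mono (h₃₄ 0) le_rfl)
  have hvbar := (hreg.continuous_inverse_apply hup).measurable.comp hYg
  change Measurable[F₄ 0] vbar at hvbar
  have hle4 := hs₄.le 0
  have hvK : ∫⁻ ω, ENNReal.ofReal (‖v ω‖ ^ 2) ∂Pr
      ≤ ENNReal.ofReal (4 * (c.dv β γ + (c.LE ^ 2 + c.sigE1) / (1 - c.q) ^ 2)) := by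
    refine (lintegral_le_of_le_mul_add (k := 2)
      (g₁ := fun ω => ENNReal.ofReal (‖v ω - vbar ω‖ ^ 2))
      (g₂ := fun ω => ENNReal.ofReal (2 / (1 - c.q) ^ 2) * ENNReal.ofReal (‖g ω‖ ^ 2))
      (by norm_num) (by positivity) (by positivity)
      (((hv4.sub hvbar).mono hle4 le_rfl).norm.pow_const 2).ennreal_ofReal
      (fun ω => ?_) hvE1
      (lintegral_le_of_le_mul (by positivity) (fun ω => le_rfl) hgK1)).trans
      (ENNReal.ofReal_le_ofReal ?_)
    · have h1 := norm_add_sq_le_two_mul (v ω - vbar ω) (vbar ω)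
      rw [sub_add_cancel] at h1
      have h2 := pow_le_pow_left₀ (norm_nonneg _) (norm_inverse_one_sub_apply_le
        (hreg.norm_adjoint_D1_le (L ω).2 (w ω)) hq1 (g ω)) 2
      rw [div_pow] at h2
      rw [← ENNReal.ofReal_mul (by norm_num), ← ENNReal.ofReal_mul (by positivity),
        ← ENNReal.ofReal_add (by positivity) (by positivity)]
      refine ENNReal.ofReal_le_ofReal (h1.trans ?_)
      have e : 2 / (1 - c.q) ^ 2 * ‖g ω‖ ^ 2 = 2 * (‖g ω‖ ^ 2 / (1 - c.q) ^ 2) := by ring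
      rw [e]
      gcongr
    · have h1 : 2 * c.dv β γ / (γ + J) ≤ 2 * c.dv β γ := div_le_self (by positivity) (by linarith)
      have e : 2 / (1 - c.q) ^ 2 * (2 * (c.LE ^ 2 + c.sigE1))
        = 4 * ((c.LE ^ 2 + c.sigE1) / (1 - c.q) ^ 2) := by ring
      rw [e]
      linarith
  -- the mini-batch Jacobian
  obtain ⟨hu, huE⟩ := lintegral_batchD2_sub_sq_le hreg hc hup horacle hs₄ hY4 hv4 hvK hJ
  set u := fun ω => ContinuousLinearMap.adjoint (batchD2 P J (fun j => zJac j ω) (w ω) (L ω))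
    (v ω) with hudef
  have hg24 : Measurable[F₄ J] g2 :=
    (hg2.mono ((h₂₃ J).trans (h₃₄ 0)) le_rfl).mono
      (monotone_nat_of_le_succ hs₄.mono (Nat.zero_le J)) le_rfl
  refine ⟨hg24.add hu, ?_⟩
  have hle := hs₄.le J
  have hm1 : Measurable fun ω => ENNReal.ofReal (‖g2 ω - grad2 P.E (w ω) (L ω)‖ ^ 2) := by
    have h1 := (Problem.continuous_of_lipschitz_each hreg.lip_grad2 hup.lip_grad2).measurable.comp
      (hY4.mono hle4 le_rfl)
    exact (((hg24.mono hle le_rfl).sub h1).norm.pow_const 2).ennreal_ofReal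
  have hm2 : Measurable fun ω => ENNReal.ofReal
      (‖u ω - ContinuousLinearMap.adjoint (D2 P.Phi (w ω) (L ω)) (v ω)‖ ^ 2) := by
    have h1 := (ContinuousLinearMap.adjoint.continuous.comp
      (Problem.continuous_of_lipschitz_each hreg.lip_D2 hup.lip_D2))
    have h2 := ((h1.comp continuous_fst).clm_apply continuous_snd).measurable.comp
      ((hY4.prodMk hv4).mono hle4 le_rfl)
    exact (((hu.mono hle le_rfl).sub h2).norm.pow_const 2).ennreal_ofReal
  have hWY : Measurable fun ω => W (w ω, L ω) := hW.comp (hY4.mono hle4 le_rfl)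
  have hm3 : Measurable fun ω => W (w ω, L ω) * ENNReal.ofReal (‖v ω - vbar ω‖ ^ 2) :=
    hWY.mul (((hv4.sub hvbar).mono hle4 le_rfl).norm.pow_const 2).ennreal_ofReal
  have hm4 : Measurable fun ω =>
      W (w ω, L ω) * ENNReal.ofReal (‖g ω - grad1 P.E (w ω) (L ω)‖ ^ 2) := by
    have h1 := (Problem.continuous_of_lipschitz_each hreg.lip_grad1 hup.lip_grad1).measurable.comp
      (hY4.mono hle4 le_rfl)
    exact hWY.mul (((hg3.mono (hs₃.le 0) le_rfl).sub h1).norm.pow_const 2).ennreal_ofReal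
  refine (lintegral_le_of_le_mul_add (by norm_num) (by positivity) (by positivity) hm1
    (fun ω => ?_) hg2E
    (lintegral_le_of_le_mul_add (k := 5) (by norm_num) (by positivity) (by positivity) hm2
      (fun ω => le_rfl) huE
    (lintegral_le_of_le_mul_add (k := 5) (by norm_num) (by positivity) (by positivity) hm3
      (fun ω => le_rfl) hvE
    (lintegral_le_of_le_mul_add (k := 5 / (1 - c.q) ^ 2) (by positivity) (by positivity)
      (by positivity) hm4 (fun ω => le_rfl) hgE
    (lintegral_le_of_le_mul (k := 5 * c.c1 ^ 2) (by positivity) (fun ω => le_rfl)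
      hwE))))).trans (ENNReal.ofReal_le_ofReal
        (c.mean_square_error_le hc hq1 hγ1.le hJ0))
  refine (ENNReal.ofReal_le_ofReal (hreg.norm_add_sub_hypergrad_sq_le hc hup (L ω).2 (w ω) (v ω)
    (g ω) (g2 ω) (u ω))).trans (le_of_eq ?_)
  simp only [hWdef]
  rw [ENNReal.ofReal_add, ENNReal.ofReal_add, ENNReal.ofReal_add, ENNReal.ofReal_add,
    ENNReal.ofReal_mul, ENNReal.ofReal_mul, ENNReal.ofReal_mul, ENNReal.ofReal_mul,
    ENNReal.ofReal_mul, ENNReal.ofReal_mul, ENNReal.ofReal_mul] <;> positivity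

end MeanSquareError

/-! ### The samples of a run in chronological order -/

/-- Position of a sampling step within one upper-level iteration; position `1` is left for the
samples of `ξ`. -/
def Step.stage : Step → ℕ
  | lowerLevel => 0
  | linearSystem => 2
  | jacobian => 3

/-- Time at which a sample is drawn: upper-level iteration, stage, index within the stage. -/
def sampleTime : (Step × ℕ × ℕ) ⊕ (ℕ × ℕ) → ℕ × ℕ × ℕ
  | .inl (p, s, i) => (s, p.stage, i)
  | .inr (s, j) => (s, 1, j)

/-- Strict lexicographic order on times. -/
def Before (a b : ℕ × ℕ × ℕ) : Prop :=
  a.1 < b.1 ∨ a.1 = b.1 ∧ (a.2.1 < b.2.1 ∨ a.2.1 = b.2.1 ∧ a.2.2 < b.2.2)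

section Past

variable {d m : ℕ} {Z Ξ Ω : Type*} [MeasurableSpace Z] [MeasurableSpace Ξ]

/-- The `σ`-algebra generated by one sample. -/
abbrev Samples.sigma (X : Samples Ω Z Ξ) : (Step × ℕ × ℕ) ⊕ (ℕ × ℕ) → MeasurableSpace Ω :=
  Sum.elim (fun a => MeasurableSpace.comap (X.zeta a) inferInstance)
    (fun a => MeasurableSpace.comap (X.xi a) inferInstance)

/-- The `σ`-algebra generated by all samples drawn before time `(s, p, i)`. -/
abbrev Samples.past (X : Samples Ω Z Ξ) (s p i : ℕ) : MeasurableSpace Ω :=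
  ⨆ a ∈ {a | Before (sampleTime a) (s, p, i)}, X.sigma a

theorem Samples.past_mono (X : Samples Ω Z Ξ) {s p i s' p' i' : ℕ}
    (h : s < s' ∨ s = s' ∧ (p < p' ∨ p = p' ∧ i ≤ i')) : X.past s p i ≤ X.past s' p' i' := by
  refine biSup_mono fun a ha => ?_
  simp only [Set.mem_ofPred_eq, Before] at ha ⊢
  omega

theorem Samples.sigma_le_past {X : Samples Ω Z Ξ} {s p i : ℕ} {a : (Step × ℕ × ℕ) ⊕ (ℕ × ℕ)}
    (ha : sampleTime a = (s, p, i)) : X.sigma a ≤ X.past s p (i + 1) := by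
  refine le_biSup X.sigma (i := a) ?_
  simp [Before, ha]

variable [mΩ : MeasurableSpace Ω] {Pr : Measure Ω} {P : Problem d m Z Ξ} {X : Samples Ω Z Ξ}

theorem Samples.IsIID.sigma_le (hX : X.IsIID P Pr) (a : (Step × ℕ × ℕ) ⊕ (ℕ × ℕ)) :
    X.sigma a ≤ mΩ := by
  rcases a with a | a
  · exact (hX.meas_zeta a).comap_le
  · exact (hX.meas_xi a).comap_le

theorem Samples.IsIID.past_le (hX : X.IsIID P Pr) (s p i : ℕ) : X.past s p i ≤ mΩ :=
  iSup₂_le fun a _ => hX.sigma_le a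

/-- A sample is independent of everything drawn before it: disjoint blocks of an independent family
of `σ`-algebras are independent. -/
theorem Samples.IsIID.indep_past (hX : X.IsIID P Pr) {s p i : ℕ}
    {a : (Step × ℕ × ℕ) ⊕ (ℕ × ℕ)} (ha : sampleTime a = (s, p, i)) :
    Indep (X.past s p i) (X.sigma a) Pr := by
  have h := indep_iSup_of_disjoint hX.sigma_le hX.indep
    (S := {a | Before (sampleTime a) (s, p, i)}) (T := {a}) (by
      rw [Set.disjoint_singleton_right]
      simp [Before, ha])
  rwa [iSup_singleton] at h

theorem Samples.IsIID.isFreshStream_zeta (hX : X.IsIID P Pr) (p : Step) (s : ℕ) :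
    IsFreshStream Pr P.lawZ (fun i => X.past s p.stage i) (fun i ω => X.zeta (p, s, i) ω) where
  le _ := hX.past_le _ _ _
  mono _ := X.past_mono (by omega)
  meas i := measurable_iff_comap_le.2 (Samples.sigma_le_past (a := .inl (p, s, i)) rfl)
  law _ := hX.law_zeta _
  indep i := hX.indep_past (a := .inl (p, s, i)) rfl

theorem Samples.IsIID.isFreshStream_xi (hX : X.IsIID P Pr) (s : ℕ) :
    IsFreshStream Pr P.lawX (fun j => X.past s 1 j) (fun j ω => X.xi (s, j) ω) where
  le _ := hX.past_le _ _ _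
  mono _ := X.past_mono (by omega)
  meas j := measurable_iff_comap_le.2 (Samples.sigma_le_past (a := .inr (s, j)) rfl)
  law _ := hX.law_xi _
  indep j := hX.indep_past (a := .inr (s, j)) rfl

end Past

/-! ### Convergence of the bilevel stochastic gradient method -/

section Convergence

variable {d m : ℕ} {Z Ξ Ω : Type*} [MeasurableSpace Z] [MeasurableSpace Ξ]
  {P : Problem d m Z Ξ} {c : Constants} {β γ α : ℝ} {η : ℕ → ℝ} {X : Samples Ω Z Ξ} {l₀ : Vec m}
  {t : ℕ → ℕ}

theorem bsgm_mem {k J : ℕ → ℕ} (hcl : IsClosed P.Lam) (hl₀ : l₀ ∈ P.Lam) (s : ℕ) (ω : Ω) :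
    bsgm P α η t k J X l₀ s ω ∈ P.Lam := by
  cases s with
  | zero => exact hl₀
  | succ s => exact (proj_spec ⟨l₀, hl₀⟩ hcl _).1

variable (P α η t X l₀) in
/-- The stochastic hypergradient used in iteration `s` of a run. -/
noncomputable def runGrad (s : ℕ) (ω : Ω) : Vec m :=
  sid P η (t s) (t s) (t s) (bsgm P α η t t t X l₀ s ω)
    (fun i => X.zeta (Step.lowerLevel, s, i) ω) (fun j => X.xi (s, j) ω)
    (fun i => X.zeta (Step.linearSystem, s, i) ω)
    (fun j => X.zeta (Step.jacobian, s, j) ω)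

theorem gap_nonneg (hl₀ : l₀ ∈ P.Lam) (hbdd : BddBelow (P.f '' P.Lam)) : 0 ≤ P.gap l₀ :=
  sub_nonneg.2 (csInf_le hbdd (Set.mem_image_of_mem P.f hl₀))

variable [mΩ : MeasurableSpace Ω] {Pr : Measure Ω} [IsProbabilityMeasure Pr]

/-- One iteration of a run, given that the current iterate depends on earlier samples only. -/
theorem runGrad_spec (hc : c.Nonneg) (hreg : P.Regular c) (hup : P.UpperRegular c)
    (horacle : P.Oracle c) (hX : X.IsIID P Pr) (hl₀ : l₀ ∈ P.Lam)
    (hβ : 1 / (1 - c.q ^ 2) < β) (hγ : β * (1 + c.sigTilde2) ≤ γ)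
    (hη : ∀ j, η j = β / (γ + j)) {s : ℕ} (ht : 1 ≤ t s)
    (hm : Measurable[X.past s 0 0] (bsgm P α η t t t X l₀ s)) :
    Measurable[X.past s 3 (t s)] (runGrad P α η X l₀ t s) ∧
    ∫⁻ ω, ENNReal.ofReal
      (‖runGrad P α η X l₀ t s ω - P.hypergrad (bsgm P α η t t t X l₀ s ω)‖ ^ 2) ∂Pr
      ≤ ENNReal.ofReal (10 * (c.cb β γ + c.cv β γ) / t s) :=
  lintegral_sid_sub_hypergrad_sq_le hc hreg hup horacle hβ hγ hη (hreg.q_nonneg hl₀)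
    (hX.isFreshStream_zeta .lowerLevel s) (hX.isFreshStream_xi s)
    (hX.isFreshStream_zeta .linearSystem s) (hX.isFreshStream_zeta .jacobian s)
    (fun i => X.past_mono (by simp [Step.stage])) (fun i => X.past_mono (by simp [Step.stage]))
    (fun i => X.past_mono (by simp [Step.stage]))
    (L := fun ω => ⟨bsgm P α η t t t X l₀ s ω, bsgm_mem hreg.closed hl₀ s ω⟩)
    (hm.subtype_mk) ht

theorem measurable_bsgm (hc : c.Nonneg) (hreg : P.Regular c) (hup : P.UpperRegular c)
    (horacle : P.Oracle c) (hX : X.IsIID P Pr) (hl₀ : l₀ ∈ P.Lam)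
    (hβ : 1 / (1 - c.q ^ 2) < β) (hγ : β * (1 + c.sigTilde2) ≤ γ)
    (hη : ∀ j, η j = β / (γ + j)) (ht : ∀ s, 1 ≤ t s) (s : ℕ) :
    Measurable[X.past s 0 0] (bsgm P α η t t t X l₀ s) := by
  induction s with
  | zero => exact measurable_const
  | succ s ih =>
    have h1 := (runGrad_spec hc hreg hup horacle hX hl₀ hβ hγ hη (ht s) ih).1.mono
      (X.past_mono (Or.inl s.lt_succ_self) : _ ≤ X.past (s + 1) 0 0) le_rfl
    have h2 := ih.mono (X.past_mono (Or.inl s.lt_succ_self) : _ ≤ X.past (s + 1) 0 0) le_rfl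
    have h3 := (lipschitzWith_proj ⟨l₀, hl₀⟩ hreg.closed hreg.convex).continuous.measurable
    exact h3.comp (h2.sub (h1.const_smul α))

/-- Convergence for an arbitrary schedule: summing the pathwise progress estimate telescopes the
objective, and the mean square errors of the stochastic hypergradients remain. -/
theorem integral_proxGrad_sum_le (hc : c.Nonneg) (hreg : P.Regular c) (hup : P.UpperRegular c)
    (horacle : P.Oracle c) (hX : X.IsIID P Pr) (hl₀ : l₀ ∈ P.Lam)
    (hbdd : BddBelow (P.f '' P.Lam)) (hβ : 1 / (1 - c.q ^ 2) < β)
    (hγ : β * (1 + c.sigTilde2) ≤ γ) (hη : ∀ j, η j = β / (γ + j)) (hα : 0 < α)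
    (hαL : α ≤ 1 / c.Lf) (ht : ∀ s, 1 ≤ t s) :
    (∀ s, Integrable (fun ω => ‖P.proxGrad α (bsgm P α η t t t X l₀ s ω)‖ ^ 2) Pr) ∧
    ∀ S : ℕ, α * ∑ s ∈ Finset.range S, ∫ ω, ‖P.proxGrad α (bsgm P α η t t t X l₀ s ω)‖ ^ 2 ∂Pr
      ≤ 2 * P.gap l₀
        + α * ∑ s ∈ Finset.range S, 10 * (c.cb β γ + c.cv β γ) / (t s : ℝ) := by
  have hγ1 := c.one_lt_gamma hc (hreg.q_nonneg hl₀) hreg.q_lt_one hβ hγ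
  have hcbv := c.cb_add_cv_nonneg (β := β) hc (γ := γ) (by linarith)
  have hLf : c.Lf * α ≤ 1 := by
    have h1 : 0 < c.Lf := one_div_pos.1 (hα.trans_le hαL)
    rwa [le_div_iff₀ h1, mul_comm] at hαL
  have hmem := fun s ω => bsgm_mem (α := α) (η := η) (t := t) (k := t) (J := t) (X := X)
    hreg.closed hl₀ s ω
  have hmeas := fun s => measurable_bsgm (α := α) hc hreg hup horacle hX hl₀ hβ hγ hη ht s
  have hspec := fun s => runGrad_spec hc hreg hup horacle hX hl₀ hβ hγ hη (ht s) (hmeas s)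
  set l := bsgm P α η t t t X l₀ with hl
  set e := fun s ω => runGrad P α η X l₀ t s ω - P.hypergrad (l s ω) with he
  have hlm : ∀ s, Measurable fun ω => (⟨l s ω, hmem s ω⟩ : P.Lam) := fun s =>
    ((hmeas s).mono (hX.past_le _ _ _) le_rfl).subtype_mk
  have hem : ∀ s, Measurable (e s) := fun s => by
    have h1 := (hreg.continuous_hypergrad hup).measurable.comp (hlm s)
    exact ((hspec s).1.mono (hX.past_le _ _ _) le_rfl).sub h1
  have hei : ∀ s, Integrable (fun ω => ‖e s ω‖ ^ 2) Pr := fun s => by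
    refine ⟨((hem s).norm.pow_const 2).aestronglyMeasurable, ?_⟩
    rw [hasFiniteIntegral_iff_ofReal (Filter.Eventually.of_forall fun ω => sq_nonneg _)]
    exact (hspec s).2.trans_lt ENNReal.ofReal_lt_top
  have hee : ∀ s, ∫ ω, ‖e s ω‖ ^ 2 ∂Pr ≤ 10 * (c.cb β γ + c.cv β γ) / t s := fun s => by
    rw [integral_eq_lintegral_of_nonneg_ae (Filter.Eventually.of_forall fun ω => sq_nonneg _)
      ((hem s).norm.pow_const 2).aestronglyMeasurable]
    refine ENNReal.toReal_le_of_le_ofReal ?_ (hspec s).2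
    positivity
  -- with `e` the error, `hypergrad + e` is the stochastic hypergradient that the run uses
  have hstep : ∀ s ω, α * ‖P.proxGrad α (l s ω)‖ ^ 2
      ≤ 2 * (P.f (l s ω) - P.f (l (s + 1) ω)) + α * ‖e s ω‖ ^ 2 := fun s ω => by
    have h1 := norm_sq_proxGrad_le (e := e s ω) hreg.closed hreg.convex (hmem s ω) hα hLf
      (fun y hy => le_quadratic_of_lipschitz_gradient hreg.convex
        (fun x hx => hreg.hasGradientWithinAt_f hx)
        (fun x hx y hy => hreg.lipschitz_hypergrad hc hup hx hy) (hmem s ω) hy)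
    have h2 : P.hypergrad (l s ω) + e s ω = runGrad P α η X l₀ t s ω := by simp [he]
    rw [h2] at h1
    exact h1
  have hpath : ∀ S ω, α * ∑ s ∈ Finset.range S, ‖P.proxGrad α (l s ω)‖ ^ 2
      ≤ 2 * P.gap l₀ + α * ∑ s ∈ Finset.range S, ‖e s ω‖ ^ 2 := fun S ω => by
    have h1 : α * ∑ s ∈ Finset.range S, ‖P.proxGrad α (l s ω)‖ ^ 2
        ≤ 2 * (P.f l₀ - P.f (l S ω)) + α * ∑ s ∈ Finset.range S, ‖e s ω‖ ^ 2 := by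
      rw [Finset.mul_sum, Finset.mul_sum]
      refine (Finset.sum_le_sum fun s _ => hstep s ω).trans (le_of_eq ?_)
      rw [Finset.sum_add_distrib, ← Finset.mul_sum,
        Finset.sum_range_sub' (fun s => P.f (l s ω)) S]
      rfl
    have h2 := csInf_le hbdd (Set.mem_image_of_mem P.f (hmem S ω))
    rw [Problem.gap]
    linarith
  have hGm : ∀ s, Measurable fun ω => ‖P.proxGrad α (l s ω)‖ ^ 2 := fun s => by
    have h1 : Continuous fun x : P.Lam => P.proxGrad α x := by
      have h2 := (lipschitzWith_proj ⟨l₀, hl₀⟩ hreg.closed hreg.convex).continuous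
      have h3 := hreg.continuous_hypergrad hup
      unfold Problem.proxGrad
      fun_prop
    exact (h1.measurable.comp (hlm s)).norm.pow_const 2
  have hsumi : ∀ S, Integrable (fun ω => 2 * P.gap l₀
      + α * ∑ s ∈ Finset.range S, ‖e s ω‖ ^ 2) Pr := fun S =>
    (integrable_const _).add ((integrable_finsetSum _ fun s _ => hei s).const_mul α)
  have hGi : ∀ s, Integrable (fun ω => ‖P.proxGrad α (l s ω)‖ ^ 2) Pr := fun s => by
    refine ((hsumi (s + 1)).const_mul α⁻¹).mono' (hGm s).aestronglyMeasurable
      (Filter.Eventually.of_forall fun ω => ?_)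
    rw [Real.norm_of_nonneg (sq_nonneg _), inv_mul_eq_div, le_div_iff₀ hα, mul_comm]
    refine le_trans ?_ (hpath (s + 1) ω)
    gcongr
    exact Finset.single_le_sum (f := fun s => ‖P.proxGrad α (l s ω)‖ ^ 2)
      (fun _ _ => sq_nonneg _) (Finset.self_mem_range_succ s)
  refine ⟨hGi, fun S => ?_⟩
  have h1 := integral_mono ((integrable_finsetSum (Finset.range S) fun s _ => hGi s).const_mul α)
    (hsumi S) (hpath S)
  rw [integral_const_mul, integral_finsetSum _ fun s _ => hGi s,
    integral_add (integrable_const _) ((integrable_finsetSum _ fun s _ => hei s).const_mul α),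
    integral_const, integral_const_mul, integral_finsetSum _ fun s _ => hei s, probReal_univ,
    one_smul] at h1
  refine h1.trans ?_
  gcongr with s
  exact hee s

/-- Average stationarity gap for a schedule whose reciprocals sum to at most `R / c₃`. -/
theorem average_proxGrad_le (hc : c.Nonneg) (hreg : P.Regular c) (hup : P.UpperRegular c)
    (horacle : P.Oracle c) (hX : X.IsIID P Pr) (hl₀ : l₀ ∈ P.Lam)
    (hbdd : BddBelow (P.f '' P.Lam)) (hβ : 1 / (1 - c.q ^ 2) < β)
    (hγ : β * (1 + c.sigTilde2) ≤ γ) (hη : ∀ j, η j = β / (γ + j)) (hα : 0 < α)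
    (hαL : α ≤ 1 / c.Lf) (ht : ∀ s, 1 ≤ t s) {c₃ R : ℝ} {S : ℕ} (hS : 1 ≤ S)
    (hR : ∑ s ∈ Finset.range S, 1 / (t s : ℝ) ≤ R / c₃) :
    1 / (S : ℝ) * ∑ s ∈ Finset.range S,
        ∫ ω, ‖P.proxGrad α (bsgm P α η t t t X l₀ s ω)‖ ^ 2 ∂Pr
      ≤ 1 / ((S : ℝ) * α) * (8 * P.gap l₀
        + 10 / c.Lf * ((c.cb β γ + c.cv β γ) / c₃) * R) := by
  have hγ1 := c.one_lt_gamma hc (hreg.q_nonneg hl₀) hreg.q_lt_one hβ hγ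
  have hcbv := c.cb_add_cv_nonneg (β := β) hc (γ := γ) (by linarith)
  have hS0 : (0 : ℝ) < S := by exact_mod_cast hS
  have hgap := gap_nonneg hl₀ hbdd
  have h1 := (integral_proxGrad_sum_le hc hreg hup horacle hX hl₀ hbdd hβ hγ hη hα hαL ht).2 S
  have h2 : ∑ s ∈ Finset.range S, 10 * (c.cb β γ + c.cv β γ) / (t s : ℝ)
      = 10 * (c.cb β γ + c.cv β γ) * ∑ s ∈ Finset.range S, 1 / (t s : ℝ) := by
    rw [Finset.mul_sum]
    refine Finset.sum_congr rfl fun s _ => by ring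
  have h0 : 0 ≤ ∑ s ∈ Finset.range S, 1 / (t s : ℝ) := Finset.sum_nonneg fun s _ => by positivity
  have h3 : α * ∑ s ∈ Finset.range S, 10 * (c.cb β γ + c.cv β γ) / (t s : ℝ)
      ≤ 1 / c.Lf * (10 * (c.cb β γ + c.cv β γ) * (R / c₃)) := by
    rw [h2]
    have := hα.le.trans hαL
    gcongr
  set Q := ∑ s ∈ Finset.range S, ∫ ω, ‖P.proxGrad α (bsgm P α η t t t X l₀ s ω)‖ ^ 2 ∂Pr
  have e : 1 / (S : ℝ) * Q = 1 / ((S : ℝ) * α) * (α * Q) := by field_simp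
  rw [e]
  gcongr
  refine h1.trans ?_
  calc _ ≤ 8 * P.gap l₀ + 1 / c.Lf * (10 * (c.cb β γ + c.cv β γ) * (R / c₃)) := by linarith
    _ = _ := by ring

end Convergence

/-! ### Sample complexity -/

theorem exists_lt_le_of_average_le {a : ℕ → ℝ} {S : ℕ} {ε : ℝ} (hS : 1 ≤ S)
    (h : 1 / (S : ℝ) * ∑ s ∈ Finset.range S, a s ≤ ε) : ∃ s < S, a s ≤ ε := by
  have hS0 : (0 : ℝ) < S := by exact_mod_cast hS
  have h1 : ∑ s ∈ Finset.range S, a s ≤ ∑ _s ∈ Finset.range S, ε := by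
    rw [one_div_mul_eq_div, div_le_iff₀ hS0] at h
    simpa [mul_comm] using h
  obtain ⟨s, hs, hle⟩ := Finset.exists_le_of_sum_le
    (Finset.nonempty_range_iff.2 (by omega)) h1
  exact ⟨s, Finset.mem_range.1 hs, hle⟩

theorem bsgmSamples_le {t : ℕ → ℕ} {c₃ : ℝ} {S : ℕ} (hS : 1 ≤ S)
    (ht : ∀ s < S, (t s : ℝ) ≤ c₃ * S + 1) :
    (bsgmSamples t t t S : ℝ) ≤ 4 * (c₃ + 1) * (S : ℝ) ^ 2 := by
  have hS0 : (1 : ℝ) ≤ S := by exact_mod_cast hS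
  have h1 : (bsgmSamples t t t S : ℝ) ≤ ∑ _s ∈ Finset.range S, 4 * (c₃ * S + 1) := by
    rw [bsgmSamples, Nat.cast_sum]
    refine Finset.sum_le_sum fun s hs => ?_
    have := ht s (Finset.mem_range.1 hs)
    simp only [sidSamples, Nat.cast_add]
    linarith
  rw [Finset.sum_const, Finset.card_range, nsmul_eq_mul] at h1
  nlinarith

/-- `K (1 + log x) / x ≤ ε` as soon as `x` is at least of order `ε⁻¹ (1 + log (1/ε))`. -/
theorem mul_one_add_log_le {K ε x : ℝ} (hK : 1 ≤ K) (hε : 0 < ε) (hε1 : ε ≤ 1)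
    (hx : 16 * K ^ 2 * (1 + Real.log (1 / ε)) / ε ≤ x) : K * (1 + Real.log x) ≤ ε * x := by
  have hℓ : 0 ≤ Real.log (1 / ε) := Real.log_nonneg (by rwa [le_div_iff₀ hε, one_mul])
  set ℓ := Real.log (1 / ε) with hℓdef
  set M := 16 * K ^ 2 * (1 + ℓ) / ε with hM
  have hM0 : 0 < M := by positivity
  have hx0 : 0 < x := hM0.trans_le hx
  -- `log (x / M) ≤ x / M - 1` takes the place of the monotonicity of `log x / x`
  have h1 : Real.log x = Real.log (x / M) + Real.log M := by
    rw [← Real.log_mul (by positivity) hM0.ne', div_mul_cancel₀ _ hM0.ne']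
  have h2 : Real.log (x / M) ≤ x / M - 1 := Real.log_le_sub_one_of_pos (by positivity)
  have h3 : Real.log M ≤ 8 * K * (1 + ℓ) := by
    have e : M = (4 * K) ^ 2 * (1 + ℓ) * (1 / ε) := by rw [hM]; ring
    rw [e, Real.log_mul (by positivity) (by positivity), Real.log_mul (by positivity)
      (by positivity), Real.log_pow]
    have h4 : Real.log (4 * K) ≤ 4 * K - 1 := Real.log_le_sub_one_of_pos (by positivity)
    have h5 : Real.log (1 + ℓ) ≤ 1 + ℓ - 1 := Real.log_le_sub_one_of_pos (by positivity)
    push_cast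
    nlinarith
  have h6 : K * (8 * K * (1 + ℓ)) ≤ ε * x / 2 := by
    have : ε * M = 16 * K ^ 2 * (1 + ℓ) := by rw [hM]; field_simp
    have := mul_le_mul_of_nonneg_left hx hε.le
    linarith
  have h7 : K * (x / M) ≤ ε * x / 16 := by
    have e : K * (x / M) = ε * x / (16 * K * (1 + ℓ)) := by
      rw [hM]; field_simp
    rw [e]
    gcongr
    nlinarith
  have h8 : K * (1 + Real.log x) ≤ K * (x / M + 8 * K * (1 + ℓ)) :=
    mul_le_mul_of_nonneg_left (by linarith) (by positivity)
  have h9 : 0 ≤ ε * x := by positivity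
  linarith

/-- Sample complexity of the increasing schedule. -/
theorem exists_complexity_log {a : ℕ → ℝ} {t : ℕ → ℕ} {c₃ K : ℝ} (hc₃ : 0 < c₃)
    (ht : ∀ s, t s = ⌈c₃ * ((s : ℝ) + 1)⌉₊)
    (ha : ∀ S : ℕ, 1 ≤ S →
      1 / (S : ℝ) * ∑ s ∈ Finset.range S, a s ≤ K * (1 + Real.log S) / S) :
    ∃ C : ℝ, ∀ ε : ℝ, 0 < ε → ε ≤ 1 → ∃ S₀ : ℕ, 1 ≤ S₀ ∧
      (bsgmSamples t t t S₀ : ℝ) ≤ C * (1 / ε ^ 2) * (1 + Real.log (1 / ε)) ^ 2 ∧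
      ∀ S, S₀ ≤ S → ∃ s < S, a s ≤ ε := by
  -- a constant that is at least `1`, so that rounding up costs at most a constant factor
  set K' := max K 1
  have hK' : 1 ≤ K' := le_max_right _ _
  refine ⟨4 * (c₃ + 1) * (17 * K' ^ 2) ^ 2, fun ε hε hε1 => ?_⟩
  have hℓ : 0 ≤ Real.log (1 / ε) := Real.log_nonneg (by rwa [le_div_iff₀ hε, one_mul])
  set ℓ := Real.log (1 / ε) with hℓdef
  have hM0 : 0 < 16 * K' ^ 2 * (1 + ℓ) / ε := by positivity
  have hS1 : 1 ≤ ⌈16 * K' ^ 2 * (1 + ℓ) / ε⌉₊ := Nat.one_le_ceil_iff.2 hM0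
  refine ⟨⌈16 * K' ^ 2 * (1 + ℓ) / ε⌉₊, hS1, ?_, fun S hS => ?_⟩
  · refine (bsgmSamples_le (c₃ := c₃) hS1 fun s hs => ?_).trans ?_
    · rw [ht]
      refine (Nat.ceil_lt_add_one (by positivity)).le.trans ?_
      have : (s : ℝ) + 1 ≤ (⌈16 * K' ^ 2 * (1 + ℓ) / ε⌉₊ : ℝ) := by exact_mod_cast hs
      gcongr
    · have h1 : (⌈16 * K' ^ 2 * (1 + ℓ) / ε⌉₊ : ℝ) ≤ 17 * K' ^ 2 * (1 + ℓ) / ε := by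
        refine (Nat.ceil_lt_add_one hM0.le).le.trans ?_
        rw [← sub_nonneg]
        have h2 : 1 ≤ K' ^ 2 * (1 + ℓ) / ε := by
          rw [le_div_iff₀ hε]
          nlinarith [one_le_pow₀ hK' (n := 2)]
        have e : 17 * K' ^ 2 * (1 + ℓ) / ε - (16 * K' ^ 2 * (1 + ℓ) / ε + 1)
            = K' ^ 2 * (1 + ℓ) / ε - 1 := by ring
        linarith
      calc 4 * (c₃ + 1) * (⌈16 * K' ^ 2 * (1 + ℓ) / ε⌉₊ : ℝ) ^ 2
          ≤ 4 * (c₃ + 1) * (17 * K' ^ 2 * (1 + ℓ) / ε) ^ 2 := by gcongr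
        _ = _ := by ring
  · have hS' : 1 ≤ S := hS1.trans hS
    have hS0 : (1 : ℝ) ≤ S := by exact_mod_cast hS'
    refine exists_lt_le_of_average_le hS' ((ha S hS').trans ?_)
    rw [div_le_iff₀ (by linarith)]
    have hlog : 0 ≤ Real.log S := Real.log_nonneg hS0
    refine le_trans ?_ (mul_one_add_log_le hK' hε hε1 ((Nat.le_ceil _).trans (by exact_mod_cast hS)))
    gcongr
    exact le_max_left _ _

/-- Sample complexity of the finite-horizon schedule. -/
theorem exists_complexity {a : ℕ → ℕ → ℝ} {t : ℕ → ℕ → ℕ} {c₃ K : ℝ} (hc₃ : 0 < c₃)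
    (ht : ∀ S s, t S s = ⌈c₃ * (S : ℝ)⌉₊)
    (ha : ∀ S : ℕ, 1 ≤ S → 1 / (S : ℝ) * ∑ s ∈ Finset.range S, a S s ≤ K / S) :
    ∃ C : ℝ, ∀ ε : ℝ, 0 < ε → ε ≤ 1 → ∃ S₀ : ℕ, 1 ≤ S₀ ∧
      (bsgmSamples (t S₀) (t S₀) (t S₀) S₀ : ℝ) ≤ C * (1 / ε ^ 2) ∧
      ∀ S, S₀ ≤ S → ∃ s < S, a S s ≤ ε := by
  -- a constant that is at least `1`, so that rounding up costs at most a constant factor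
  set K' := max K 1
  have hK' : 1 ≤ K' := le_max_right _ _
  refine ⟨4 * (c₃ + 1) * (2 * K') ^ 2, fun ε hε hε1 => ?_⟩
  have hM0 : 0 < K' / ε := by positivity
  have hS1 : 1 ≤ ⌈K' / ε⌉₊ := Nat.one_le_ceil_iff.2 hM0
  refine ⟨⌈K' / ε⌉₊, hS1, ?_, fun S hS => ?_⟩
  · refine (bsgmSamples_le (c₃ := c₃) hS1 fun s _ => ?_).trans ?_
    · rw [ht]
      exact (Nat.ceil_lt_add_one (by positivity)).le
    · have h1 : (⌈K' / ε⌉₊ : ℝ) ≤ 2 * K' / ε := by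
        refine (Nat.ceil_lt_add_one hM0.le).le.trans ?_
        have h2 : 1 ≤ K' / ε := by
          rw [le_div_iff₀ hε]
          linarith
        have e : 2 * K' / ε = K' / ε + K' / ε := by ring
        linarith
      calc 4 * (c₃ + 1) * (⌈K' / ε⌉₊ : ℝ) ^ 2 ≤ 4 * (c₃ + 1) * (2 * K' / ε) ^ 2 := by gcongr
        _ = _ := by ring
  · have hS' : 1 ≤ S := hS1.trans hS
    have hS0 : (1 : ℝ) ≤ S := by exact_mod_cast hS'
    refine exists_lt_le_of_average_le hS' ((ha S hS').trans ?_)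
    rw [div_le_iff₀ (by linarith)]
    have h1 : K' / ε ≤ S := (Nat.le_ceil _).trans (by exact_mod_cast hS)
    rw [div_le_iff₀ hε] at h1
    calc K ≤ K' := le_max_left _ _
      _ ≤ _ := by linarith

end Bilevel

theorem mainTheorem1 {d m : ℕ} {Z Ξ Ω : Type*}
    [MeasurableSpace Z] [MeasurableSpace Ξ] [MeasurableSpace Ω]
    (Pr : Measure Ω) [IsProbabilityMeasure Pr]
    (P : Problem d m Z Ξ) (c : Constants) (hc : c.Nonneg)
    (hreg : P.Regular c) (hup : P.UpperRegular c) (horacle : P.Oracle c)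
    (X : Samples Ω Z Ξ) (hX : X.IsIID P Pr)
    (l₀ : Vec m) (hl₀ : l₀ ∈ P.Lam) (hbdd : BddBelow (P.f '' P.Lam))
    (β γ : ℝ) (hβ : 1 / (1 - c.q ^ 2) < β) (hγ : β * (1 + c.sigTilde2) ≤ γ)
    (η : ℕ → ℝ) (hη : ∀ j, η j = β / (γ + j))
    (α : ℝ) (hα : 0 < α) (hαL : α ≤ 1 / c.Lf)
    (c₃ : ℝ) (hc₃ : 0 < c₃) :
    -- the hypergradient is the gradient of the objective relative to the feasible set
    (∀ l ∈ P.Lam, HasGradientWithinAt P.f (P.hypergrad l) P.Lam l) ∧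
    -- (i) increasing schedule
    (∀ t : ℕ → ℕ, (∀ s, t s = ⌈c₃ * ((s : ℝ) + 1)⌉₊) →
      ∀ G : ℕ → Ω → ℝ, (∀ s ω, G s ω = ‖P.proxGrad α (bsgm P α η t t t X l₀ s ω)‖ ^ 2) →
      (∀ s, Integrable (G s) Pr) ∧
      (∀ S : ℕ, 1 ≤ S →
        1 / (S : ℝ) * ∑ s ∈ Finset.range S, ∫ ω, G s ω ∂Pr ≤
          1 / ((S : ℝ) * α) * (8 * P.gap l₀
            + 10 / c.Lf * ((c.cb β γ + c.cv β γ) / c₃) * (Real.log S + 1))) ∧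
      ∃ C : ℝ, ∀ ε : ℝ, 0 < ε → ε ≤ 1 → ∃ S₀ : ℕ, 1 ≤ S₀ ∧
        (bsgmSamples t t t S₀ : ℝ) ≤ C * (1 / ε ^ 2) * (1 + Real.log (1 / ε)) ^ 2 ∧
        ∀ S, S₀ ≤ S → ∃ s < S, ∫ ω, G s ω ∂Pr ≤ ε) ∧
    -- (ii) finite horizon: one run for each horizon `S`
    (∀ t : ℕ → ℕ → ℕ, (∀ S s, t S s = ⌈c₃ * (S : ℝ)⌉₊) →
      ∀ G : ℕ → ℕ → Ω → ℝ,
        (∀ S s ω, G S s ω = ‖P.proxGrad α (bsgm P α η (t S) (t S) (t S) X l₀ s ω)‖ ^ 2) →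
      (∀ S s, s < S → Integrable (G S s) Pr) ∧
      (∀ S : ℕ, 1 ≤ S →
        1 / (S : ℝ) * ∑ s ∈ Finset.range S, ∫ ω, G S s ω ∂Pr ≤
          1 / ((S : ℝ) * α) * (8 * P.gap l₀
            + 10 / c.Lf * ((c.cb β γ + c.cv β γ) / c₃))) ∧
      ∃ C : ℝ, ∀ ε : ℝ, 0 < ε → ε ≤ 1 → ∃ S₀ : ℕ, 1 ≤ S₀ ∧
        (bsgmSamples (t S₀) (t S₀) (t S₀) S₀ : ℝ) ≤ C * (1 / ε ^ 2) ∧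
        ∀ S, S₀ ≤ S → ∃ s < S, ∫ ω, G S s ω ∂Pr ≤ ε) := by
  refine ⟨fun l hl => hreg.hasGradientWithinAt_f hl, fun t ht G hG => ?_, fun t ht G hG => ?_⟩
  · have ht1 : ∀ s, 1 ≤ t s := fun s => by
      rw [ht]
      exact Nat.one_le_ceil_iff.2 (by positivity)
    have hGe : ∀ s, G s = fun ω => ‖P.proxGrad α (bsgm P α η t t t X l₀ s ω)‖ ^ 2 := fun s =>
      funext (hG s)
    simp only [hGe]
    have hbound : ∀ S : ℕ, 1 ≤ S → 1 / (S : ℝ) * ∑ s ∈ Finset.range S,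
        ∫ ω, ‖P.proxGrad α (bsgm P α η t t t X l₀ s ω)‖ ^ 2 ∂Pr ≤
          1 / ((S : ℝ) * α) * (8 * P.gap l₀
            + 10 / c.Lf * ((c.cb β γ + c.cv β γ) / c₃) * (Real.log S + 1)) := fun S hS => by
      refine average_proxGrad_le hc hreg hup horacle hX hl₀ hbdd hβ hγ hη hα hαL ht1 hS ?_
      have h1 := harmonic_le_one_add_log S
      rw [harmonic, Rat.cast_sum] at h1
      rw [le_div_iff₀ hc₃, Finset.sum_mul, add_comm]
      refine le_trans (Finset.sum_le_sum fun s _ => ?_) h1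
      push_cast
      rw [one_div_mul_eq_div, div_le_iff₀ (by exact_mod_cast ht1 s), inv_mul_eq_div,
        le_div_iff₀ (by positivity), ht]
      exact Nat.le_ceil _
    refine ⟨(integral_proxGrad_sum_le hc hreg hup horacle hX hl₀ hbdd hβ hγ hη hα hαL ht1).1,
      hbound, ?_⟩
    set A := 10 / c.Lf * ((c.cb β γ + c.cv β γ) / c₃)
    refine exists_complexity_log (K := (8 * P.gap l₀ + A) / α) hc₃ ht fun S hS =>
      (hbound S hS).trans ?_
    have hS0 : (1 : ℝ) ≤ S := by exact_mod_cast hS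
    have hgap := gap_nonneg hl₀ hbdd
    have hlog := Real.log_nonneg hS0
    calc _ ≤ 1 / ((S : ℝ) * α) * ((8 * P.gap l₀ + A) * (1 + Real.log S)) := by
          gcongr
          nlinarith
      _ = _ := by field_simp
  · have ht1 : ∀ S, 1 ≤ S → ∀ s, 1 ≤ t S s := fun S hS s => by
      rw [ht]
      have : (0 : ℝ) < S := by exact_mod_cast hS
      exact Nat.one_le_ceil_iff.2 (by positivity)
    have hGe : ∀ S s, G S s
        = fun ω => ‖P.proxGrad α (bsgm P α η (t S) (t S) (t S) X l₀ s ω)‖ ^ 2 := fun S s =>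
      funext (hG S s)
    simp only [hGe]
    have hbound : ∀ S : ℕ, 1 ≤ S → 1 / (S : ℝ) * ∑ s ∈ Finset.range S,
        ∫ ω, ‖P.proxGrad α (bsgm P α η (t S) (t S) (t S) X l₀ s ω)‖ ^ 2 ∂Pr ≤
          1 / ((S : ℝ) * α) * (8 * P.gap l₀
            + 10 / c.Lf * ((c.cb β γ + c.cv β γ) / c₃)) := fun S hS => by
      have hS0 : (0 : ℝ) < S := by exact_mod_cast hS
      have h := average_proxGrad_le (R := 1) (c₃ := c₃) hc hreg hup horacle hX hl₀ hbdd hβ hγ hη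
        hα hαL (ht1 S hS) hS ?_
      · simpa only [mul_one] using h
      · have h1 : ∀ s ∈ Finset.range S, 1 / (t S s : ℝ) ≤ 1 / (c₃ * S) := fun s _ => by
          rw [ht]
          gcongr
          exact Nat.le_ceil _
        refine (Finset.sum_le_sum h1).trans (le_of_eq ?_)
        rw [Finset.sum_const, Finset.card_range, nsmul_eq_mul]
        field_simp
    refine ⟨fun S s hs => (integral_proxGrad_sum_le hc hreg hup horacle hX hl₀ hbdd hβ hγ hη hα
      hαL (ht1 S (by omega))).1 s, hbound, ?_⟩
    refine exists_complexity
      (K := (8 * P.gap l₀ + 10 / c.Lf * ((c.cb β γ + c.cv β γ) / c₃)) / α) hc₃ ht fun S hS =>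
      (hbound S hS).trans (le_of_eq ?_)
    have hS0 : (0 : ℝ) < S := by exact_mod_cast hS
    field_simp
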